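/- Let $K$ be a field of characteristic $0$ (for instance $\mathbb R$ or $\mathbb C$), let $U=K^s$ with coordinates $x=(x_1,\dots,x_s)$, and let $V=U^*$ with dual coordinates $y=(y_1,\dots,y_s)$, so that $\langle y|x\rangle=\sum_i y_ix_i$. Let $X=(a_1,\dots,a_N)$ be a list (repetitions allowed) of nonzero elements of $V$ that spans $V$, regarded as linear forms on $U$. Put $d(x)=\prod_{a\in X}a$ and $R_X=K[x_1,\dots,x_s][d^{-1}]$, and let $R_{X,s-1}\subset R_X$ be the subspace spanned by the fractions $f\prod_{a\in X}a^{-h_a}$ ($f$ a polynomial, $h_a\ge 0$) for which $\{a: h_a>0\}$ spans a space of dimension $<s$. A basis $\underline b=(b_1,\dots,b_s)=(a_{i_1},\dots,a_{i_s})$, $i_1<\dots<i_s$, extracted from $X$ is *no broken* if the only elements $a_i$ of the list for which there is an $e$ with $i\le i_e$ and $a_i\in\langle b_e,\dots,b_s\rangle$ are the elements of $\underline b$ themselves (elements of the list being distinguished by their index). Let $\mathcal{NB}(X)$ be the set of no broken bases. Define $\det(\underline b)$ by $db_1\wedge\dots\wedge db_s=\det(\underline b)\,dx_1\wedge\dots\wedge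 dx_s$. For $\underline b\in\mathcal{NB}(X)$ let $j_{\underline b}:R_X\to K[[u_1,\dots,u_s]][(u_1\cdots u_s)^{-1}]$ be the $K$-algebra homomorphism with $b_i\mapsto u_1u_2\cdots u_i$ for $i=1,\dots,s$, extended to differential forms. For $f\in R_X$ let $res_{\underline b}(f)$ be the coefficient of $(u_1\cdots u_s)^{-1}du_1\wedge\dots\wedge du_s$ in $j_{\underline b}(f\,dx_1\wedge\dots\wedge dx_s)$. For a power series in $y$ with coefficients in $R_X$, $res_{\underline b}$ is taken coefficient by coefficient. **Theorem.** There is a unique family of polynomials $p_{\underline b,X}\in K[y_1,\dots,y_s]$, $\underline b\in\mathcal{NB}(X)$, homogeneous of degree $N-s$, such that $$\frac1{d}=\sum_{\underline b\in\mathcal{NB}(X)}p_{\underline b,X}(\partial_x)\,\frac1{\prod_{a\in\underline b}a}\qquad\text{in } R_X/R_{X,s-1},$$ where $p(\partial_x)$ denotes $p(\partial/\partial x_1,\dots,\partial/\partial x_s)$; and for every $\underline b\in\mathcal{NB}(X)$ these polynomials satisfy $$p_{\underline b,X}(-y)=\det(\underline b)\;res_{\underline b}\!\left(\frac{e^{\langle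 y|x\rangle}}{d(x)}\right),$$ where $e^{\langle y|x\rangle}/d(x)$ is expanded as a power series in $y$ with coefficients in $R_X$. -/

import Mathlib

namespace LocalResidue

open MvPolynomial

section Arrangement

variable {K : Type*} [Field K] {s N : ℕ}

/-- The linear form `a₁ x₁ + ⋯ + aₛ xₛ` on `U = Kˢ` attached to the vector `a` of `V = U*`,
given by its coordinates. -/
noncomputable def linForm (a : Fin s → K) : MvPolynomial (Fin s) K :=
  ∑ k, C (a k) * X k

/-- The product `d(x) = ∏ a` of the list `A` of linear forms. -/
noncomputable def denom (A : Fin N → Fin s → K) : MvPolynomial (Fin s) K :=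
  ∏ i, linForm (A i)

/-- The ring `R_X = S[V][∏ a⁻¹]` of the list `A`, the coordinate ring of the complement of the
hyperplane arrangement. -/
abbrev ArrRing (A : Fin N → Fin s → K) : Type _ := Localization.Away (denom A)

/-- The element `1 / aᵢ` of `R_X`, obtained as `(∏_{j ≠ i} aⱼ) / d`. -/
noncomputable def invForm (A : Fin N → Fin s → K) (i : Fin N) : ArrRing A :=
  algebraMap (MvPolynomial (Fin s) K) (ArrRing A) (∏ j ∈ Finset.univ.erase i, linForm (A j)) *
    IsLocalization.Away.invSelf (denom A)

theorem linForm_mul_invForm (A : Fin N → Fin s → K) (i : Fin N) :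
    algebraMap (MvPolynomial (Fin s) K) (ArrRing A) (linForm (A i)) * invForm A i = 1 := by
  rw [invForm, ← mul_assoc, ← map_mul, Finset.mul_prod_erase Finset.univ (fun j => linForm (A j))
    (Finset.mem_univ i)]
  exact IsLocalization.Away.mul_invSelf (denom A)

/-- The Taylor map `f(x) ↦ f(x + ε eₖ) = f + ε ∂f/∂xₖ` on polynomials, with values in the dual
numbers over `R_X`. -/
noncomputable def taylorHom (A : Fin N → Fin s → K) (k : Fin s) :
    MvPolynomial (Fin s) K →ₐ[K] DualNumber (ArrRing A) :=
  aeval fun j => TrivSqZeroExt.inl (algebraMap (MvPolynomial (Fin s) K) (ArrRing A) (X j)) +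
    TrivSqZeroExt.inr (if j = k then 1 else 0)

theorem taylorHom_fst (A : Fin N → Fin s → K) (k : Fin s) (f : MvPolynomial (Fin s) K) :
    (taylorHom A k f).fst = algebraMap (MvPolynomial (Fin s) K) (ArrRing A) f := by
  have h : (TrivSqZeroExt.fstHom K (ArrRing A) (ArrRing A)).comp (taylorHom A k) =
      IsScalarTower.toAlgHom K (MvPolynomial (Fin s) K) (ArrRing A) := by
    apply MvPolynomial.algHom_ext
    intro j
    by_cases hj : j = k <;> simp [taylorHom, hj]
  exact DFunLike.congr_fun h f

theorem taylorHom_isUnit (A : Fin N → Fin s → K) (k : Fin s) :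
    IsUnit (taylorHom A k (denom A)) := by
  rw [TrivSqZeroExt.isUnit_iff_isUnit_fst, taylorHom_fst]
  exact IsLocalization.Away.algebraMap_isUnit (denom A)

/-- The Taylor map `f(x) ↦ f(x + ε eₖ)` on `R_X`. -/
noncomputable def taylorLoc (A : Fin N → Fin s → K) (k : Fin s) :
    ArrRing A →ₐ[K] DualNumber (ArrRing A) :=
  IsLocalization.Away.liftAlgHom (denom A) (taylorHom_isUnit A k)

theorem taylorLoc_algebraMap (A : Fin N → Fin s → K) (k : Fin s) (f : MvPolynomial (Fin s) K) :
    taylorLoc A k (algebraMap _ _ f) = taylorHom A k f := by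
  rw [taylorLoc, IsLocalization.Away.liftAlgHom_apply, IsLocalization.Away.lift_eq]
  rfl

theorem taylorLoc_fst (A : Fin N → Fin s → K) (k : Fin s) (z : ArrRing A) :
    (taylorLoc A k z).fst = z := by
  have h : (TrivSqZeroExt.fstHom K (ArrRing A) (ArrRing A)).comp (taylorLoc A k) =
      AlgHom.id K (ArrRing A) := by
    apply AlgHom.coe_ringHom_injective
    apply IsLocalization.ringHom_ext (Submonoid.powers (denom A))
    refine RingHom.ext fun f => ?_
    simp [taylorLoc_algebraMap, taylorHom_fst]
  exact DFunLike.congr_fun h z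

/-- The partial derivative `∂/∂xₖ` of `R_X`. -/
noncomputable def partialD (A : Fin N → Fin s → K) (k : Fin s) :
    Derivation K (ArrRing A) (ArrRing A) :=
  Derivation.mk' ((TrivSqZeroExt.sndHom (ArrRing A) (ArrRing A)).restrictScalars K ∘ₗ
    (taylorLoc A k).toLinearMap) (by
      intro a b
      simp [taylorLoc_fst, mul_comm])

/-- `∂/∂xₖ` on `R_X` extends the partial derivative of polynomials. -/
theorem partialD_algebraMap (A : Fin N → Fin s → K) (k : Fin s) (f : MvPolynomial (Fin s) K) :
    partialD A k (algebraMap _ _ f) = algebraMap _ _ (pderiv k f) := by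
  have hD : ∀ z, partialD A k z = (taylorLoc A k z).snd := fun _ => rfl
  rw [hD, taylorLoc_algebraMap]
  induction f using MvPolynomial.induction_on with
  | C a => simp [taylorHom, TrivSqZeroExt.algebraMap_eq_inl']
  | add p q hp hq => simp [hp, hq]
  | mul_X p j hp =>
    rw [map_mul, TrivSqZeroExt.snd_mul, hp, taylorHom_fst, Derivation.leibniz, pderiv_X]
    by_cases hj : j = k
    · subst hj
      simp [taylorHom, mul_comm]
    · simp [taylorHom, hj, mul_comm]

/-- The constant coefficient differential operator `p(∂ₓ)` on `R_X`, for a polynomial `p` on `V`: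
the monomial `∏ yᵢ ^ αᵢ` acts as `∏ (∂/∂xᵢ) ^ αᵢ`. -/
noncomputable def diffOp (A : Fin N → Fin s → K) (p : MvPolynomial (Fin s) K) :
    Module.End K (ArrRing A) :=
  ∑ α ∈ p.support, p.coeff α • (List.ofFn fun i : Fin s =>
    ((partialD A i : ArrRing A →ₗ[K] ArrRing A) : Module.End K (ArrRing A)) ^ α i).prod

/-- The part `R_{X,s-1}` of the filtration of `R_X` by polar order: it is spanned by the fractions
`f ∏ a ^ (-hₐ)` for which the `a` with `hₐ > 0` span a space of dimension less than `s`. -/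
noncomputable def lowerPolar (A : Fin N → Fin s → K) : Submodule K (ArrRing A) :=
  Submodule.span K {z | ∃ (f : MvPolynomial (Fin s) K) (h : Fin N → ℕ),
    Module.finrank K (Submodule.span K (A '' {i | 0 < h i})) < s ∧
      z = algebraMap (MvPolynomial (Fin s) K) (ArrRing A) f * ∏ i, invForm A i ^ h i}

/-- The set `B(b)` of the (positions of the) elements of the list `A` that break the sublist `b`:
`aᵢ` breaks `b` if, for some `e`, it stands not after `b_e` in the list and it is linearly dependent
on `b_e, …, b_s`. -/
def breakingSet (A : Fin N → Fin s → K) (b : Fin s ↪o Fin N) : Set (Fin N) :=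
  {i | ∃ e : Fin s, i ≤ b e ∧ A i ∈ Submodule.span K ((fun j => A (b j)) '' Set.Ici e)}

/-- A no broken basis extracted from the list `A`, given by the increasing sequence of the positions
of its elements. -/
structure NoBrokenBasis (A : Fin N → Fin s → K) where
  idx : Fin s ↪o Fin N
  linearIndependent : LinearIndependent K fun e => A (idx e)
  breakingSet_eq : breakingSet A idx = Set.range idx

instance (A : Fin N → Fin s → K) : Finite (NoBrokenBasis A) :=
  Finite.of_injective (fun b => (b.idx : Fin s → Fin N)) (by
    rintro ⟨b, _, _⟩ ⟨c, _, _⟩ h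
    have : b = c := DFunLike.coe_injective h
    subst this
    rfl)

noncomputable instance (A : Fin N → Fin s → K) : Fintype (NoBrokenBasis A) := Fintype.ofFinite _

/-- The family `p` consists of homogeneous polynomials of degree `|X| - s`, and
`1 / d = ∑ p_b(∂ₓ) (1 / ∏_{a ∈ b} a)` holds in the module of polar parts `R_X / R_{X,s-1}`,
the sum running over the no broken bases `b`. -/
structure IsLocalExpansion (A : Fin N → Fin s → K)
    (p : NoBrokenBasis A → MvPolynomial (Fin s) K) : Prop where
  homogeneous : ∀ b, (p b).IsHomogeneous (N - s)
  expansion : (lowerPolar A).mkQ (∏ i, invForm A i) =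
    (lowerPolar A).mkQ (∑ b, diffOp A (p b) (∏ e, invForm A (b.idx e)))

/-- The polynomials `p_{b,X}`: the family satisfying `IsLocalExpansion`. -/
noncomputable def localPoly (A : Fin N → Fin s → K) :
    NoBrokenBasis A → MvPolynomial (Fin s) K :=
  Classical.epsilon (IsLocalExpansion A)

end Arrangement

section Laurent

variable (s : ℕ) (K : Type*) [Field K]

/-- The product `u₁ ⋯ uₛ`. -/
noncomputable def allVars : MvPowerSeries (Fin s) K := ∏ i, MvPowerSeries.X i

/-- The ring `K[[u₁, …, uₛ]][(u₁ ⋯ uₛ)⁻¹]` of formal Laurent series. -/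
abbrev LaurentRing : Type _ := Localization.Away (allVars s K)

variable {s K}

/-- The exponent `(n, …, n)`. -/
noncomputable def constExp (s n : ℕ) : Fin s →₀ ℕ := Finsupp.equivFunOnFinite.symm fun _ => n

/-- The coefficient of `(u₁ ⋯ uₛ)⁻¹` in a Laurent series `z`: if `z = g / (u₁ ⋯ uₛ) ^ n`, it is the
coefficient of `(u₁ ⋯ uₛ) ^ n` in `g · u₁ ⋯ uₛ`. -/
noncomputable def coeffInv (z : LaurentRing s K) : K :=
  MvPowerSeries.coeff (constExp s (IsLocalization.Away.sec (allVars s K) z).2)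
    ((IsLocalization.Away.sec (allVars s K) z).1 * allVars s K)

theorem allVars_pow (n : ℕ) :
    allVars s K ^ n = MvPowerSeries.monomial (constExp s n) (1 : K) := by
  have h1 : allVars s K = MvPowerSeries.monomial (constExp s 1) (1 : K) := by
    have h2 : constExp s 1 = ∑ i : Fin s, Finsupp.single i 1 := by
      ext j
      simp [constExp, Finsupp.finsetSum_apply, Finsupp.single_apply]
    rw [h2, allVars]
    generalize (Finset.univ : Finset (Fin s)) = t
    induction t using Finset.induction_on with
    | empty => simp
    | insert a t ha ih =>
      rw [Finset.prod_insert ha, Finset.sum_insert ha, ih, MvPowerSeries.X,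
        MvPowerSeries.monomial_mul_monomial, one_mul]
  rw [h1, MvPowerSeries.monomial_pow, one_pow]
  congr 2
  ext j
  simp [constExp]

/-- The coefficient of `(u₁ ⋯ uₛ)⁻¹` does not depend on the representation as a fraction. -/
theorem coeffInv_eq (z : LaurentRing s K) (g : MvPowerSeries (Fin s) K) (n : ℕ)
    (h : z * algebraMap _ _ (allVars s K) ^ (n + 1) = algebraMap _ _ g) :
    coeffInv z = MvPowerSeries.coeff (constExp s n) g := by
  have hne : allVars s K ≠ 0 := Finset.prod_ne_zero_iff.mpr fun i _ => by
    intro h0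
    have := congrArg (MvPowerSeries.coeff (Finsupp.single i 1)) h0
    rw [MvPowerSeries.coeff_X] at this
    simp at this
  have hinj : Function.Injective (algebraMap (MvPowerSeries (Fin s) K) (LaurentRing s K)) :=
    IsLocalization.injective _ (powers_le_nonZeroDivisors_of_noZeroDivisors hne)
  have hadd : ∀ a b, constExp s (a + b) = constExp s a + constExp s b := by
    intro a b
    ext j
    simp [constExp]
  have hcoeff : ∀ (a b : ℕ) (f : MvPowerSeries (Fin s) K),
      MvPowerSeries.coeff (constExp s (a + b)) (f * allVars s K ^ b) =
        MvPowerSeries.coeff (constExp s a) f := by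
    intro a b f
    rw [allVars_pow, hadd, MvPowerSeries.coeff_add_mul_monomial, mul_one]
  have hsec := IsLocalization.Away.sec_spec (allVars s K) z
  set m := (IsLocalization.Away.sec (allVars s K) z).2
  set g₀ := (IsLocalization.Away.sec (allVars s K) z).1
  have key : g₀ * allVars s K ^ (n + 1) = g * allVars s K ^ m := by
    apply hinj
    rw [map_mul, map_mul, ← hsec, ← h]
    simp only [map_pow]
    ring
  change MvPowerSeries.coeff (constExp s m) (g₀ * allVars s K) = _
  rw [← hcoeff m n (g₀ * allVars s K), ← hcoeff n m g, ← key, Nat.add_comm n m, pow_succ]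
  congr 1
  ring

end Laurent

section Residue

variable {K : Type*} [Field K] {s N : ℕ}

/-- The matrix of the coordinates of the elements of the sublist `b` of `A`, one row for each
element. Its determinant is `det(b)`, that is `db₁ ∧ ⋯ ∧ dbₛ = det(b) dx₁ ∧ ⋯ ∧ dxₛ`. -/
def basisMatrix (A : Fin N → Fin s → K) (b : Fin s → Fin N) : Matrix (Fin s) (Fin s) K :=
  Matrix.of fun e => A (b e)

/-- The substitution `f(b₁, …, bₛ) ↦ f(u₁, u₁ u₂, …, u₁ u₂ ⋯ uₛ)` on polynomials: in terms of the
coordinates it replaces `xₖ = ∑ⱼ (B⁻¹)ₖⱼ bⱼ` by `∑ⱼ (B⁻¹)ₖⱼ u₁ ⋯ uⱼ`. -/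
noncomputable def monSubst (A : Fin N → Fin s → K) (b : Fin s → Fin N) :
    MvPolynomial (Fin s) K →ₐ[K] MvPolynomial (Fin s) K :=
  aeval fun k => ∑ j, C ((basisMatrix A b)⁻¹ k j) * ∏ i ∈ Finset.Iic j, X i

theorem basisMatrix_isUnit_det {A : Fin N → Fin s → K} {b : Fin s → Fin N}
    (hb : LinearIndependent K fun e => A (b e)) : IsUnit (basisMatrix A b).det := by
  rw [← Matrix.isUnit_iff_isUnit_det, ← Matrix.linearIndependent_rows_iff_isUnit]
  exact hb

theorem monSubst_linForm (A : Fin N → Fin s → K) {b : Fin s → Fin N}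
    (hb : LinearIndependent K fun e => A (b e)) (e : Fin s) :
    monSubst A b (linForm (A (b e))) = ∏ i ∈ Finset.Iic e, X i := by
  have h : ∀ j, ∑ k, A (b e) k * (basisMatrix A b)⁻¹ k j = if e = j then 1 else 0 := by
    intro j
    have := congrFun (congrFun (Matrix.mul_nonsing_inv _ (basisMatrix_isUnit_det hb)) e) j
    rwa [Matrix.mul_apply, Matrix.one_apply] at this
  simp only [linForm, monSubst, map_sum, map_mul, aeval_X, Finset.mul_sum, algHom_C,
    algebraMap_eq]
  rw [Finset.sum_comm]
  simp only [← mul_assoc, ← C_mul]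
  simp only [← Finset.sum_mul, ← map_sum, h]
  simp

/-- The substitution, with values in the ring of Laurent series. -/
noncomputable def laurentSubst (A : Fin N → Fin s → K) (b : Fin s → Fin N) :
    MvPolynomial (Fin s) K →ₐ[K] LaurentRing s K :=
  ((IsScalarTower.toAlgHom K (MvPowerSeries (Fin s) K) (LaurentRing s K)).comp
    (MvPolynomial.coeToMvPowerSeries.algHom K)).comp (monSubst A b)

theorem laurentSubst_isUnit {A : Fin N → Fin s → K} (hA : ∀ i, A i ≠ 0) {b : Fin s → Fin N}
    (hb : LinearIndependent K fun e => A (b e)) : IsUnit (laurentSubst A b (denom A)) := by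
  classical
  rw [denom, map_prod, IsUnit.prod_univ_iff]
  intro i
  obtain ⟨c, hc⟩ : ∃ c : Fin s → K, A i = ∑ e, c e • A (b e) := by
    have hsp := hb.span_eq_top_of_card_eq_finrank' (by simp)
    have hmem : A i ∈ Submodule.span K (Set.range fun e => A (b e)) := hsp ▸ Submodule.mem_top
    obtain ⟨c, hc⟩ := (Submodule.mem_span_range_iff_exists_fun K).mp hmem
    exact ⟨c, hc.symm⟩
  have hform : linForm (A i) = ∑ e, C (c e) * linForm (A (b e)) := by
    simp only [linForm, hc, Finset.mul_sum]
    rw [Finset.sum_comm]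
    refine Finset.sum_congr rfl fun k _ => ?_
    simp [Finset.sum_apply, Finset.sum_mul, mul_assoc]
  have hex : (Finset.univ.filter fun e => c e ≠ 0).Nonempty := by
    by_contra hcon
    rw [Finset.not_nonempty_iff_eq_empty] at hcon
    apply hA i
    rw [hc]
    refine Finset.sum_eq_zero fun e _ => ?_
    have : e ∉ Finset.univ.filter fun e => c e ≠ 0 := by simp [hcon]
    have : c e = 0 := by simpa using this
    simp [this]
  set k := (Finset.univ.filter fun e => c e ≠ 0).min' hex with hk
  have hck : c k ≠ 0 := by
    have := Finset.min'_mem _ hex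
    simpa using this
  have hlt : ∀ e, e < k → c e = 0 := by
    intro e he
    by_contra hce
    exact absurd (Finset.min'_le _ e (by simpa using hce)) (not_le.mpr he)
  have hfac : monSubst A b (linForm (A i)) =
      (∏ l ∈ Finset.Iic k, X l) *
        (∑ e ∈ Finset.Ici k, C (c e) * ∏ l ∈ Finset.Ioc k e, X l) := by
    rw [hform, map_sum, Finset.mul_sum]
    symm
    apply Finset.sum_subset_zero_on_sdiff (Finset.subset_univ _)
    · intro e he
      have : e < k := by simpa using he
      simp [hlt e this]
    · intro e he
      have hke : k ≤ e := by simpa using he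
      rw [map_mul, monSubst_linForm A hb, algHom_C, algebraMap_eq, mul_left_comm]
      congr 1
      rw [← Finset.prod_union]
      · congr 1
        ext l
        simp only [Finset.mem_union, Finset.mem_Iic, Finset.mem_Ioc]
        omega
      · rw [Finset.disjoint_left]
        intro l hl hl'
        simp only [Finset.mem_Iic, Finset.mem_Ioc] at hl hl'
        omega
  have happ : ∀ f, laurentSubst A b f = algebraMap (MvPowerSeries (Fin s) K) (LaurentRing s K)
      (MvPolynomial.coeToMvPowerSeries.ringHom (monSubst A b f)) := fun f => rfl
  rw [happ, hfac, map_mul, map_mul]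
  refine IsUnit.mul ?_ ?_
  · refine isUnit_of_dvd_unit ?_ (IsLocalization.Away.algebraMap_isUnit (allVars s K))
    apply map_dvd
    rw [map_prod, allVars]
    have : ∀ l : Fin s, MvPolynomial.coeToMvPowerSeries.ringHom (R := K) (X l) =
      MvPowerSeries.X l := fun l => by simp
    simp only [this]
    exact Finset.prod_dvd_prod_of_subset _ _ _ (Finset.subset_univ _)
  · apply IsUnit.map
    rw [MvPowerSeries.isUnit_iff_constantCoeff]
    have hcc : MvPowerSeries.constantCoeff (MvPolynomial.coeToMvPowerSeries.ringHom
        (∑ e ∈ Finset.Ici k, C (c e) * ∏ l ∈ Finset.Ioc k e, X l : MvPolynomial (Fin s) K)) =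
        c k := by
      rw [map_sum, map_sum, Finset.sum_eq_single k]
      · simp
      · intro e he hek
        have hke : k < e := lt_of_le_of_ne (by simpa using he) (Ne.symm hek)
        rw [map_mul, map_mul, map_prod, map_prod]
        rw [Finset.prod_eq_zero (i := e) (by simpa using hke) (by simp), mul_zero]
      · simp
    rw [hcc]
    exact hck.isUnit

/-- The homomorphism `j_b : R_X → K[[u₁, …, uₛ]][(u₁ ⋯ uₛ)⁻¹]` with `bᵢ ↦ u₁ ⋯ uᵢ`. -/
noncomputable def expand (A : Fin N → Fin s → K) (hA : ∀ i, A i ≠ 0) (b : Fin s → Fin N)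
    (hb : LinearIndependent K fun e => A (b e)) : ArrRing A →ₐ[K] LaurentRing s K :=
  IsLocalization.Away.liftAlgHom (denom A) (laurentSubst_isUnit hA hb)

/-- The Jacobian determinant of the substitution: `dx₁ ∧ ⋯ ∧ dxₛ` becomes
`jacobian · du₁ ∧ ⋯ ∧ duₛ`. -/
noncomputable def jacobian (A : Fin N → Fin s → K) (b : Fin s → Fin N) :
    MvPolynomial (Fin s) K :=
  (Matrix.of fun i k : Fin s => pderiv k (monSubst A b (X i))).det

/-- The local residue `res_b(f)` of `f ∈ R_X`, that is of the form `f dx₁ ∧ ⋯ ∧ dxₛ`: the coefficient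
of `(u₁ ⋯ uₛ)⁻¹ du₁ ∧ ⋯ ∧ duₛ` in its image under the substitution `j_b`. -/
noncomputable def res (A : Fin N → Fin s → K) (hA : ∀ i, A i ≠ 0) (b : NoBrokenBasis A)
    (f : ArrRing A) : K :=
  coeffInv (expand A hA b.idx b.linearIndependent f *
    algebraMap (MvPowerSeries (Fin s) K) (LaurentRing s K) (jacobian A b.idx))

/-- The residue of a power series in `y₁, …, yₛ` with coefficients in `R_X`, taken coefficient by
coefficient. -/
noncomputable def resSeries (A : Fin N → Fin s → K) (hA : ∀ i, A i ≠ 0) (b : NoBrokenBasis A)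
    (F : MvPowerSeries (Fin s) (ArrRing A)) : MvPowerSeries (Fin s) K :=
  fun α => res A hA b (MvPowerSeries.coeff α F)

/-- The power series `e^{⟨y|x⟩} = ∑_α (x^α / α!) y^α` in `y`, with coefficients in `R_X`. -/
noncomputable def expPairing (A : Fin N → Fin s → K) : MvPowerSeries (Fin s) (ArrRing A) :=
  fun α => algebraMap (MvPolynomial (Fin s) K) (ArrRing A)
    (monomial α (∏ i, ((α i).factorial : K))⁻¹)

end Residue

end LocalResidue

namespace LocalResidue

open MvPolynomial

/-! ### Constant coefficient operators on `R_X`, and antiderivatives of fractions of lower polar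
order. -/

section Derivations

variable {K : Type*} [Field K] {s N : ℕ} (A : Fin N → Fin s → K)

/-! The residues `res_b` form, up to the scalars `det(b)`, a system dual to the fractions `1 / ∏_{a
∈ c} a` of the no broken bases; pairing an expansion of `1/d` with `e^{⟨y|x⟩}` reads off its
coefficients.

Three facts carry this. Residues kill derivatives (`resLin_partialD`): in the coordinates `b_e`,
`∂/∂b_e` is `b_e⁻¹` times an Euler operator, whose weight is zero at the one exponent that the
residue reads. Residues kill `R_{X,s-1}` (`resLin_lowerPolar`): in characteristic zero such a
fraction has an antiderivative along a vector on which all its polar forms vanish. Finally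
`res_b(1/∏c)` is `det(b)⁻¹` if `c = b` and `0` otherwise (`res_prod_invForm_self`,
`res_prod_invForm_of_ne`); the no broken condition enters here, through `NoBrokenBasis.eq_of_flag`.

By integration by parts, `z ↦ res_b(e^{⟨y|x⟩} z)` turns `p(∂ₓ)` into multiplication by `p(-y)`. It
also kills `R_{X,s-1}` and sends `1/∏c` to the constant `res_b(1/∏c)`. Applied to any expansion of
`1/d` it gives `p_b(-y) / det(b)`, which is both the formula and uniqueness
(`IsLocalExpansion.formula`, `IsLocalExpansion.unique`).

Existence is a rewriting argument (`prod_invForm_pow_mem_expandable`): a linear relation between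
forms trades a pole for an earlier one in the list. When no trade is possible, the poles either fail
to span or form a no broken basis, and in the latter case the fraction is a derivative of the simple
one. -/

theorem ArrRing.exists_mul_pow (z : ArrRing A) : ∃ (f : MvPolynomial (Fin s) K) (n : ℕ),
    z * algebraMap (MvPolynomial (Fin s) K) (ArrRing A) (denom A) ^ n = algebraMap _ _ f := by
  obtain ⟨n, f, h⟩ := IsLocalization.Away.surj (denom A) z
  exact ⟨f, n, h⟩

/-- A linear map from `R_X` satisfying the Leibniz rule along an algebra homomorphism `j` vanishes
as soon as it kills the coordinates. -/
theorem eq_zero_of_leibniz {H : Type*} [CommRing H] [Algebra K H] (j : ArrRing A →ₐ[K] H)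
    (E : ArrRing A →ₗ[K] H) (hE : ∀ x y, E (x * y) = j x * E y + j y * E x)
    (hX : ∀ k, E (algebraMap (MvPolynomial (Fin s) K) (ArrRing A) (X k)) = 0) (z : ArrRing A) :
    E z = 0 := by
  have h1 : E 1 = 0 := by simpa using hE 1 1
  have hpoly : ∀ f, E (algebraMap (MvPolynomial (Fin s) K) (ArrRing A) f) = 0 := by
    intro f
    induction f using MvPolynomial.induction_on with
    | C a =>
      rw [← algebraMap_eq, ← IsScalarTower.algebraMap_apply, Algebra.algebraMap_eq_smul_one,
        map_smul, h1, smul_zero]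
    | add p q hp hq => rw [map_add, map_add, hp, hq, add_zero]
    | mul_X p i hp => rw [map_mul, hE, hp, hX, mul_zero, mul_zero, add_zero]
  obtain ⟨f, n, h⟩ := ArrRing.exists_mul_pow A z
  -- Leibniz on `z · dⁿ = f` leaves `j(dⁿ) · E z = 0`, and `j(dⁿ)` is a unit.
  have h2 := hE z (algebraMap _ _ (denom A) ^ n)
  rw [h, hpoly, ← map_pow, hpoly, mul_zero, zero_add] at h2
  have hu : IsUnit (j (algebraMap _ _ (denom A ^ n))) := by
    rw [map_pow]
    exact ((IsLocalization.Away.algebraMap_isUnit (denom A)).pow n).map j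
  exact (hu.mul_right_eq_zero).mp h2.symm

theorem partialD_X (k i : Fin s) :
    partialD A k (algebraMap (MvPolynomial (Fin s) K) (ArrRing A) (X i)) =
      if i = k then 1 else 0 := by
  rw [partialD_algebraMap, pderiv_X]
  by_cases h : i = k
  · subst h; simp
  · simp [h]

/-- The commutator is again a derivation, and it kills the coordinates because their derivatives are
constants. -/
theorem partialD_comm (k l : Fin s) (z : ArrRing A) :
    partialD A k (partialD A l z) = partialD A l (partialD A k z) := by
  have h : ⁅partialD A k, partialD A l⁆ z = 0 := by
    refine eq_zero_of_leibniz A (AlgHom.id K _)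
      ((⁅partialD A k, partialD A l⁆ : Derivation K (ArrRing A) (ArrRing A)) :
        ArrRing A →ₗ[K] ArrRing A) ?_ ?_ z
    · intro x y
      exact Derivation.leibniz _ x y
    · intro i
      simp only [Derivation.coeFn_coe, Derivation.commutator_apply, partialD_X]
      split_ifs <;> simp
  rw [Derivation.commutator_apply] at h
  exact sub_eq_zero.mp h

/-- The subalgebra of endomorphisms of `R_X` generated by the partial derivatives. -/
noncomputable def partialAlg : Subalgebra K (Module.End K (ArrRing A)) :=
  Algebra.adjoin K (Set.range fun i : Fin s =>
    ((partialD A i : ArrRing A →ₗ[K] ArrRing A) : Module.End K (ArrRing A)))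

/-- Evaluating a polynomial at the `∂_k` with `aeval` needs a commutative target, which the full
endomorphism ring is not. -/
theorem partialAlg_mul_comm (x y : partialAlg A) : x * y = y * x :=
  (Algebra.isMulCommutative_adjoin K (by
    rintro _ ⟨k, rfl⟩ _ ⟨l, rfl⟩
    exact LinearMap.ext fun z => partialD_comm A k l z)).is_comm.comm x y

noncomputable instance : CommRing (partialAlg A) :=
  { (partialAlg A).toRing with mul_comm := partialAlg_mul_comm A }

/-- Constant coefficient differential operators on `R_X` as an algebra homomorphism. -/
noncomputable def diffOpHom : MvPolynomial (Fin s) K →ₐ[K] Module.End K (ArrRing A) :=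
  (partialAlg A).val.comp (aeval fun i : Fin s => (⟨(partialD A i : ArrRing A →ₗ[K] ArrRing A),
    Algebra.subset_adjoin ⟨i, rfl⟩⟩ : partialAlg A))

/-- Makes `diffOp`, defined by a sum over monomials, multiplicative as well as additive. -/
theorem diffOpHom_apply (p : MvPolynomial (Fin s) K) : diffOpHom A p = diffOp A p := by
  rw [diffOpHom, AlgHom.comp_apply, aeval_def, eval₂_eq', diffOp, map_sum]
  refine Finset.sum_congr rfl fun α _ => ?_
  rw [← Algebra.smul_def, map_smul, ← List.prod_ofFn, map_list_prod, List.map_ofFn]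
  rfl

theorem diffOp_add (p q : MvPolynomial (Fin s) K) :
    diffOp A (p + q) = diffOp A p + diffOp A q := by
  simp only [← diffOpHom_apply, map_add]

theorem diffOp_smul (c : K) (p : MvPolynomial (Fin s) K) :
    diffOp A (c • p) = c • diffOp A p := by
  simp only [← diffOpHom_apply, map_smul]

theorem diffOp_mul (p q : MvPolynomial (Fin s) K) (z : ArrRing A) :
    diffOp A (p * q) z = diffOp A p (diffOp A q z) := by
  simp only [← diffOpHom_apply, map_mul, Module.End.mul_apply]

theorem diffOp_C (c : K) (z : ArrRing A) : diffOp A (C c) z = c • z := by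
  rw [← diffOpHom_apply, ← algebraMap_eq, AlgHom.commutes]
  rfl

theorem diffOp_X (k : Fin s) (z : ArrRing A) : diffOp A (X k) z = partialD A k z := by
  rw [← diffOpHom_apply, diffOpHom, AlgHom.comp_apply, aeval_X]
  rfl

/-- The derivative of `R_X` along the vector `v`. -/
noncomputable def dirD (v : Fin s → K) : Derivation K (ArrRing A) (ArrRing A) :=
  ∑ k, v k • partialD A k

theorem dirD_apply (v : Fin s → K) (z : ArrRing A) : dirD A v z = ∑ k, v k • partialD A k z := by
  rw [dirD, ← Derivation.coeFnAddMonoidHom_apply, map_sum, Finset.sum_apply]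
  rfl

theorem diffOp_linForm (v : Fin s → K) (z : ArrRing A) :
    diffOp A (linForm v) z = dirD A v z := by
  rw [dirD_apply, ← diffOpHom_apply, linForm, map_sum, LinearMap.sum_apply]
  refine Finset.sum_congr rfl fun k _ => ?_
  rw [diffOpHom_apply, diffOp_mul, diffOp_C, diffOp_X]

theorem dirD_linForm (v a : Fin s → K) :
    dirD A v (algebraMap (MvPolynomial (Fin s) K) (ArrRing A) (linForm a)) =
      algebraMap K _ (∑ k, v k * a k) := by
  rw [dirD_apply, map_sum]
  refine Finset.sum_congr rfl fun k _ => ?_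
  have h : pderiv k (linForm a) = C (a k) := by
    simp [linForm, pderiv_X, Pi.single_apply]
  rw [partialD_algebraMap, h, ← algebraMap_eq, ← IsScalarTower.algebraMap_apply, map_mul,
    ← Algebra.smul_def]

theorem dirD_invForm (v : Fin s → K) (i : Fin N) :
    dirD A v (invForm A i) = -((∑ k, v k * A i k) • invForm A i ^ 2) := by
  rw [Derivation.leibniz_of_mul_eq_one (dirD A v)
    ((mul_comm _ _).trans (linForm_mul_invForm A i)), dirD_linForm, smul_eq_mul,
    neg_mul, mul_comm, Algebra.smul_def]

theorem dirD_prod_invForm_pow_eq_zero (v : Fin s → K) (h : Fin N → ℕ)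
    (hv : ∀ i, 0 < h i → ∑ k, v k * A i k = 0) :
    dirD A v (∏ i, invForm A i ^ h i) = 0 := by
  refine Finset.prod_induction _ (fun z => dirD A v z = 0) (fun x y hx hy => ?_)
    (Derivation.map_one_eq_zero _) fun i _ => ?_
  · rw [Derivation.leibniz, hx, hy, smul_zero, smul_zero, add_zero]
  · rw [Derivation.leibniz_pow, dirD_invForm]
    rcases Nat.eq_zero_or_pos (h i) with h0 | h0
    · simp [h0]
    · simp [hv i h0]

/-- In characteristic zero every polynomial is a derivative along any nonzero vector. -/
theorem exists_sum_smul_pderiv_eq [CharZero K] (v : Fin s → K) (hv : v ≠ 0)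
    (f : MvPolynomial (Fin s) K) : ∃ g, ∑ k, v k • pderiv k g = f := by
  classical
  obtain ⟨k, hk : v k ≠ 0⟩ := Function.ne_iff.mp hv
  let D : MvPolynomial (Fin s) K →ₗ[K] MvPolynomial (Fin s) K :=
    ∑ j, v j • (pderiv j : Derivation K _ _).toLinearMap
  have hD : ∀ g, D g = ∑ j, v j • pderiv j g := fun g => by simp [D, LinearMap.sum_apply]
  -- Induction on the degree in the variables other than `x_k`: integrating a monomial in `x_k`
  -- solves the equation up to terms `v_j ∂_j` with `j ≠ k`, where that degree has dropped by one.
  suffices h : ∀ (n : ℕ) (α : Fin s →₀ ℕ), ∑ j ∈ Finset.univ.erase k, α j = n → ∀ c,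
      monomial α c ∈ LinearMap.range D by
    have : f ∈ LinearMap.range D := by
      rw [f.as_sum]
      exact Submodule.sum_mem _ fun α _ => h _ α rfl _
    obtain ⟨g, hg⟩ := this
    exact ⟨g, (hD g).symm.trans hg⟩
  intro n
  induction n using Nat.strong_induction_on with
  | _ n ih =>
  intro α hα c
  have hne : (v k * (α k + 1) : K) ≠ 0 := mul_ne_zero hk (Nat.cast_add_one_ne_zero _)
  set c' := c / (v k * (α k + 1)) with hc'
  have h1 : D (monomial (α + Finsupp.single k 1) c') = monomial α c +
      ∑ j ∈ Finset.univ.erase k, v j •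
        monomial (α + Finsupp.single k 1 - Finsupp.single j 1) (c' * α j) := by
    rw [hD, ← Finset.add_sum_erase _ _ (Finset.mem_univ k)]
    congr 1
    · rw [pderiv_monomial, add_tsub_cancel_right, smul_monomial]
      congr 1
      simp only [Finsupp.add_apply, Finsupp.single_eq_same, hc']
      push_cast
      simp only [smul_eq_mul]
      field_simp
    · refine Finset.sum_congr rfl fun j hj => ?_
      rw [pderiv_monomial]
      have : (Finsupp.single k 1 : Fin s →₀ ℕ) j = 0 :=
        Finsupp.single_eq_of_ne (Finset.ne_of_mem_erase hj)
      simp [this]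
  rw [eq_sub_of_add_eq h1.symm]
  refine Submodule.sub_mem _ ⟨_, rfl⟩ (Submodule.sum_mem _ fun j hj => Submodule.smul_mem _ _ ?_)
  rcases Nat.eq_zero_or_pos (α j) with h0 | h0
  · simp [h0]
  · refine ih _ ?_ _ rfl _
    rw [← hα]
    have hjk : j ≠ k := Finset.ne_of_mem_erase hj
    refine Finset.sum_lt_sum (fun i hi => ?_) ⟨j, hj, ?_⟩
    · have : (Finsupp.single k 1 : Fin s →₀ ℕ) i = 0 :=
        Finsupp.single_eq_of_ne (Finset.ne_of_mem_erase hi)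
      simp [this]
    · have : (Finsupp.single k 1 : Fin s →₀ ℕ) j = 0 := Finsupp.single_eq_of_ne hjk
      simp only [Finsupp.tsub_apply, Finsupp.add_apply, this, Finsupp.single_eq_same]
      omega

/-- Elements of lower polar order are combinations of derivatives. -/
theorem lowerPolar_le_span_partialD [CharZero K] :
    lowerPolar A ≤ Submodule.span K {z | ∃ k w, partialD A k w = z} := by
  rw [lowerPolar, Submodule.span_le]
  rintro z ⟨f, h, hW, rfl⟩
  set W := Submodule.span K (A '' {i | 0 < h i}) with hWdef
  have hlt : W < ⊤ := lt_top_iff_ne_top.mpr fun htop => by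
    rw [htop, finrank_top, Module.finrank_fin_fun] at hW
    exact lt_irrefl _ hW
  -- A functional on `V` vanishing on the span of the polar forms is a vector `v` of `U` along which
  -- the denominator is constant. Only the numerator then has to be integrated along `v`.
  obtain ⟨φ, hφ, hle⟩ := W.exists_le_ker_of_lt_top hlt
  set v : Fin s → K := fun k => φ (Pi.single k 1) with hvdef
  have hφv : ∀ a, φ a = ∑ k, v k * a k := fun a => by
    rw [LinearMap.pi_apply_eq_sum_univ φ a]
    refine Finset.sum_congr rfl fun k _ => ?_
    rw [smul_eq_mul, mul_comm, hvdef]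
    congr 3
    ext j
    simp [Pi.single_apply, eq_comm]
  have hv : v ≠ 0 := fun h0 => hφ (LinearMap.ext fun a => by simp [hφv, h0])
  obtain ⟨g, hg⟩ := exists_sum_smul_pderiv_eq v hv f
  have hDg : dirD A v (algebraMap _ _ g) = algebraMap _ _ f := by
    rw [dirD_apply, ← hg, map_sum]
    refine Finset.sum_congr rfl fun k _ => ?_
    rw [partialD_algebraMap, smul_eq_C_mul, map_mul, ← algebraMap_eq,
      ← IsScalarTower.algebraMap_apply, Algebra.smul_def]
  have hD : dirD A v (algebraMap _ _ g * ∏ i, invForm A i ^ h i) =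
      algebraMap _ _ f * ∏ i, invForm A i ^ h i := by
    rw [Derivation.leibniz, dirD_prod_invForm_pow_eq_zero A v h, hDg, smul_zero, zero_add,
      smul_eq_mul, mul_comm]
    intro i hi
    rw [← hφv]
    exact hle (Submodule.subset_span ⟨i, hi, rfl⟩)
  rw [SetLike.mem_coe, ← hD, dirD_apply]
  exact Submodule.sum_mem _ fun k _ => Submodule.smul_mem _ _ (Submodule.subset_span ⟨k, _, rfl⟩)

/-- Lets the coefficients `x^α / α!` of the exponential act on the module of polar parts. -/
theorem algebraMap_mul_mem_lowerPolar (f : MvPolynomial (Fin s) K) {z : ArrRing A}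
    (hz : z ∈ lowerPolar A) : algebraMap _ _ f * z ∈ lowerPolar A := by
  induction hz using Submodule.span_induction with
  | mem z hz =>
    obtain ⟨g, h, hW, rfl⟩ := hz
    exact Submodule.subset_span ⟨f * g, h, hW, by rw [map_mul, mul_assoc]⟩
  | zero => simp
  | add x y _ _ hx hy => rw [mul_add]; exact Submodule.add_mem _ hx hy
  | smul c x _ hx => rw [mul_smul_comm]; exact Submodule.smul_mem _ _ hx

theorem exists_prod_invForm_pow_eq (b : Fin s → Fin N) (T : Finset (Fin s))
    (h : Fin s → ℕ) : ∃ h' : Fin N → ℕ, (∏ e ∈ T, invForm A (b e) ^ h e = ∏ i, invForm A i ^ h' i) ∧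
      {i | 0 < h' i} ⊆ b '' (T : Set (Fin s)) := by
  classical
  -- Exponents are added over the fibres, as `b` is not assumed injective.
  refine ⟨fun i => ∑ e ∈ T, if b e = i then h e else 0, ?_, ?_⟩
  · simp_rw [← Finset.prod_pow_eq_pow_sum]
    rw [Finset.prod_comm]
    refine Finset.prod_congr rfl fun e _ => ?_
    rw [Finset.prod_eq_single (b e)]
    · simp
    · intro i _ hi
      simp [hi.symm]
    · simp
  · intro i hi
    obtain ⟨e, he, hne⟩ := Finset.exists_ne_zero_of_sum_ne_zero (Nat.pos_iff_ne_zero.mp hi)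
    refine ⟨e, he, ?_⟩
    by_contra hcon
    exact hne (if_neg hcon)

end Derivations

/-! ### Laurent series as Hahn series over `ℤˢ`, with their Euler operators. -/

section Hahn

variable {K : Type*} [Field K] {s N : ℕ}

/-- The inclusion of exponents `ℕˢ ⊆ ℤˢ`. -/
def expInt (s : ℕ) : (Fin s →₀ ℕ) →+ (Fin s → ℤ) where
  toFun α i := α i
  map_zero' := by ext; simp
  map_add' α β := by ext; simp

theorem expInt_apply (α : Fin s →₀ ℕ) (i : Fin s) : expInt s α i = α i := rfl

theorem expInt_le (α β : Fin s →₀ ℕ) : expInt s α ≤ expInt s β ↔ α ≤ β := by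
  simp [Pi.le_def, expInt_apply, Finsupp.le_def]

theorem expInt_injective : Function.Injective (expInt s) := fun α β h => by
  ext i
  exact Int.ofNat_inj.mp (congrFun h i)

variable (K s) in
/-- Power series as Hahn series with exponents in `ℤˢ`. -/
noncomputable def psToHahn : MvPowerSeries (Fin s) K →+* HahnSeries (Fin s → ℤ) K :=
  (HahnSeries.embDomainRingHom (expInt s) expInt_injective expInt_le).comp
    (HahnSeries.toMvPowerSeries (σ := Fin s) (R := K)).symm.toRingHom

theorem coeff_psToHahn (g : MvPowerSeries (Fin s) K) (α : Fin s →₀ ℕ) :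
    (psToHahn K s g).coeff (expInt s α) = MvPowerSeries.coeff α g :=
  HahnSeries.embDomain_coeff
    (f := ⟨⟨expInt s, expInt_injective⟩, fun {a b} => expInt_le a b⟩)

theorem psToHahn_monomial (α : Fin s →₀ ℕ) (c : K) :
    psToHahn K s (MvPowerSeries.monomial α c) = HahnSeries.single (expInt s α) c := by
  have h : (HahnSeries.toMvPowerSeries (σ := Fin s) (R := K)).symm (MvPowerSeries.monomial α c) =
      HahnSeries.single α c := by
    ext β
    rw [HahnSeries.coeff_toMvPowerSeries_symm, MvPowerSeries.coeff_monomial,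
      HahnSeries.coeff_single]
    congr
  change HahnSeries.embDomain _ (HahnSeries.toMvPowerSeries.symm _) = _
  rw [h]
  exact HahnSeries.embDomain_single

theorem psToHahn_allVars_pow (n : ℕ) :
    psToHahn K s (allVars s K ^ n) = HahnSeries.single (fun _ => (n : ℤ)) 1 := by
  rw [allVars_pow, psToHahn_monomial]
  rfl

theorem isUnit_single (β : Fin s → ℤ) : IsUnit (HahnSeries.single β (1 : K)) :=
  IsUnit.of_mul_eq_one (HahnSeries.single (-β) 1) (by
    rw [HahnSeries.single_mul_single, add_neg_cancel, one_mul, HahnSeries.single_zero_one])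

theorem psToHahn_allVars_isUnit : IsUnit (psToHahn K s (allVars s K)) := by
  rw [← pow_one (allVars s K), psToHahn_allVars_pow]
  exact isUnit_single _

variable (K s) in
/-- Laurent series as Hahn series with exponents in `ℤˢ`. -/
noncomputable def toHahn : LaurentRing s K →+* HahnSeries (Fin s → ℤ) K :=
  IsLocalization.Away.lift (allVars s K) psToHahn_allVars_isUnit

theorem toHahn_algebraMap (g : MvPowerSeries (Fin s) K) :
    toHahn K s (algebraMap _ _ g) = psToHahn K s g :=
  IsLocalization.Away.lift_eq _ _ _

/-- `coeffInv` goes through a chosen fraction; as a coefficient of a Hahn series it is visibly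
linear and stable under shifts of the exponent. -/
theorem coeffInv_eq_coeff_toHahn (z : LaurentRing s K) :
    coeffInv z = (toHahn K s z).coeff (fun _ => -1) := by
  obtain ⟨n, g, h⟩ := IsLocalization.Away.surj (allVars s K) z
  have h1 : z * algebraMap _ _ (allVars s K) ^ (n + 1) = algebraMap _ _ (g * allVars s K) := by
    rw [pow_succ, ← mul_assoc, h, map_mul]
  rw [coeffInv_eq z _ n h1, ← coeff_psToHahn, ← toHahn_algebraMap, ← h1, ← map_pow, map_mul,
    toHahn_algebraMap, psToHahn_allVars_pow]
  have h2 : expInt s (constExp s n) = (fun _ => -1) + fun _ => ((n + 1 : ℕ) : ℤ) := by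
    ext i
    simp [expInt_apply, constExp]
  rw [h2, HahnSeries.coeff_mul_single_add, mul_one]

/-- Multiplication of the coefficients of a Hahn series by an additive function of the exponent. -/
def weightD (l : (Fin s → ℤ) →+ ℤ) :
    HahnSeries (Fin s → ℤ) K →ₗ[K] HahnSeries (Fin s → ℤ) K where
  toFun x := ⟨fun β => (l β : K) * x.coeff β, x.isPWO_support.mono fun β h h0 => h (by simp [h0])⟩
  map_add' x y := by ext β; simp [mul_add]
  map_smul' c x := by ext β; simp [mul_left_comm]

theorem coeff_weightD (l : (Fin s → ℤ) →+ ℤ) (x : HahnSeries (Fin s → ℤ) K) (β : Fin s → ℤ) :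
    (weightD l x).coeff β = l β * x.coeff β := rfl

/-- The weight is additive on exponents, so it splits over each term of the convolution. Both
products are summed over the supports of `x` and `y`, since weighting can only shrink a support. -/
theorem weightD_mul (l : (Fin s → ℤ) →+ ℤ) (x y : HahnSeries (Fin s → ℤ) K) :
    weightD l (x * y) = x * weightD l y + y * weightD l x := by
  have hs : ∀ z : HahnSeries (Fin s → ℤ) K, (weightD l z).support ⊆ z.support :=
    fun z β h h0 => h (by simp [coeff_weightD, h0])
  ext β
  rw [mul_comm y, HahnSeries.coeff_add, coeff_weightD,
    HahnSeries.coeff_mul_right' y.isPWO_support (hs y),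
    HahnSeries.coeff_mul_left' x.isPWO_support (hs x), HahnSeries.coeff_mul, Finset.mul_sum,
    ← Finset.sum_add_distrib]
  refine Finset.sum_congr rfl fun ij h => ?_
  rw [Finset.mem_antidiagonal] at h
  rw [← h.2.2, map_add, coeff_weightD, coeff_weightD]
  push_cast
  ring

theorem weightD_single (l : (Fin s → ℤ) →+ ℤ) (β : Fin s → ℤ) (c : K) :
    weightD l (HahnSeries.single β c) = (l β : K) • HahnSeries.single β c := by
  ext γ
  rw [coeff_weightD, HahnSeries.coeff_smul, smul_eq_mul, HahnSeries.coeff_single]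
  by_cases h : γ = β
  · rw [h]
  · simp [h]

/-- The exponent in `u` of the monomial `u₁ ⋯ u_e`. -/
def flagExp (e : Fin s) : Fin s → ℤ := fun i => if i ≤ e then 1 else 0

/-- The exponent of `b_e` in a Laurent monomial in `u`. -/
def flagCoord (e : Fin s) : (Fin s → ℤ) →+ ℤ where
  -- The monomial `∏ b_e ^ m_e` has `u`-exponent `β_i = ∑_{e ≥ i} m_e`, so `m_e = β_e - β_{e+1}`,
  -- where the entry past the last one counts as `0`.
  toFun β := β e - if h : (e : ℕ) + 1 < s then β ⟨e + 1, h⟩ else 0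
  map_zero' := by simp
  map_add' α β := by
    split_ifs <;> simp only [Pi.add_apply] <;> ring

theorem flagCoord_flagExp (e f : Fin s) : flagCoord e (flagExp f) = if e = f then 1 else 0 := by
  have hf := f.isLt
  simp only [flagCoord, flagExp, AddMonoidHom.coe_mk, ZeroHom.coe_mk, Fin.le_def, Fin.ext_iff]
  split_ifs <;> omega

theorem monomial_prod_Iic (e : Fin s) :
    psToHahn K s ((∏ i ∈ Finset.Iic e, X i : MvPolynomial (Fin s) K) : MvPowerSeries (Fin s) K) =
      HahnSeries.single (flagExp e) 1 := by
  have h : (∏ i ∈ Finset.Iic e, X i : MvPolynomial (Fin s) K) =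
      monomial (∑ i ∈ Finset.Iic e, Finsupp.single i 1) 1 := by
    rw [monomial_sum_one]
    rfl
  rw [h, MvPolynomial.coe_monomial, psToHahn_monomial]
  have h' : expInt s (∑ i ∈ Finset.Iic e, Finsupp.single i 1) = flagExp e := by
    ext i
    rw [expInt_apply]
    simp [flagExp, Finsupp.finsetSum_apply, Finsupp.single_apply]
  rw [h']

end Hahn

/-! ### The Jacobian of the monomial substitution. -/

section Jacobian

variable {K : Type*} [Field K] {s N : ℕ}

theorem pderiv_prod_X_of_notMem {k : Fin s} {T : Finset (Fin s)} (h : k ∉ T) :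
    pderiv k (∏ i ∈ T, X i : MvPolynomial (Fin s) K) = 0 := by
  refine Finset.prod_induction _ (fun z => pderiv k z = 0) (fun x y hx hy => ?_)
    (Derivation.map_one_eq_zero _) fun i hi => ?_
  · rw [Derivation.leibniz, hx, hy, smul_zero, smul_zero, add_zero]
  · exact pderiv_X_of_ne (ne_of_mem_of_not_mem hi h)

theorem pderiv_prod_X_mul {k : Fin s} {T : Finset (Fin s)} (h : k ∈ T) :
    pderiv k (∏ i ∈ T, X i : MvPolynomial (Fin s) K) * X k = ∏ i ∈ T, X i := by
  rw [← Finset.mul_prod_erase T _ h, Derivation.leibniz,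
    pderiv_prod_X_of_notMem (Finset.notMem_erase k T), pderiv_X_self, smul_zero, zero_add,
    smul_eq_mul, mul_one, mul_comm]

/-- Chain rule: `x` is linear in `b` with matrix `B⁻¹`, and `b_j = u₁ ⋯ u_j` has a lower triangular
Jacobian whose diagonal entry times `u_j` is `b_j`. The factor `∏ u_i` avoids division. -/
theorem jacobian_mul_prod_X (A : Fin N → Fin s → K) (b : Fin s → Fin N) :
    jacobian A b * ∏ i, X i =
      C (basisMatrix A b)⁻¹.det * ∏ j, ∏ i ∈ Finset.Iic j, (X i : MvPolynomial (Fin s) K) := by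
  set M : Matrix (Fin s) (Fin s) (MvPolynomial (Fin s) K) :=
    Matrix.of fun j k => pderiv k (∏ i ∈ Finset.Iic j, X i)
  have h1 : (Matrix.of fun i k : Fin s => pderiv k (monSubst A b (X i))) =
      (C : K →+* MvPolynomial (Fin s) K).mapMatrix (basisMatrix A b)⁻¹ * M := by
    ext1 i k
    rw [Matrix.mul_apply, Matrix.of_apply, monSubst, aeval_X, map_sum]
    refine Finset.sum_congr rfl fun j _ => ?_
    rw [pderiv_C_mul]
    rfl
  have h2 : M.det = ∏ j, M j j := Matrix.det_of_isLowerTriangular M fun j k hjk =>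
    pderiv_prod_X_of_notMem (by simpa using hjk)
  rw [jacobian, h1, Matrix.det_mul, ← RingHom.map_det, h2, mul_assoc, ← Finset.prod_mul_distrib]
  congr 1
  exact Finset.prod_congr rfl fun j _ => pderiv_prod_X_mul (by simp)

end Jacobian

/-! ### Residues vanish on derivatives and on lower polar order. -/

section ResidueOfDerivative

variable {K : Type*} [Field K] {s N : ℕ}

theorem expand_algebraMap (A : Fin N → Fin s → K) (hA : ∀ i, A i ≠ 0) (b : Fin s → Fin N)
    (hb : LinearIndependent K fun e => A (b e)) (f : MvPolynomial (Fin s) K) :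
    expand A hA b hb (algebraMap _ _ f) =
      algebraMap (MvPowerSeries (Fin s) K) (LaurentRing s K) (monSubst A b f) := by
  rw [expand, IsLocalization.Away.liftAlgHom_apply, IsLocalization.Away.lift_eq]
  rfl

/-- The homomorphism `j_b` with values in Hahn series. -/
noncomputable def hahnExpand (A : Fin N → Fin s → K) (hA : ∀ i, A i ≠ 0) (b : Fin s → Fin N)
    (hb : LinearIndependent K fun e => A (b e)) : ArrRing A →ₐ[K] HahnSeries (Fin s → ℤ) K :=
  { (toHahn K s).comp (expand A hA b hb : ArrRing A →+* LaurentRing s K) with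
    commutes' := fun c => by
      have h : algebraMap K (ArrRing A) c =
          algebraMap (MvPolynomial (Fin s) K) (ArrRing A) (C c) := by
        rw [← algebraMap_eq, ← IsScalarTower.algebraMap_apply]
      change toHahn K s (expand A hA b hb (algebraMap K (ArrRing A) c)) = _
      rw [h, expand_algebraMap, algHom_C, algebraMap_eq, toHahn_algebraMap, MvPolynomial.coe_C,
        ← MvPowerSeries.monomial_zero_eq_C_apply, psToHahn_monomial, map_zero]
      rfl }

theorem hahnExpand_apply (A : Fin N → Fin s → K) (hA : ∀ i, A i ≠ 0) (b : Fin s → Fin N)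
    (hb : LinearIndependent K fun e => A (b e)) (z : ArrRing A) :
    hahnExpand A hA b hb z = toHahn K s (expand A hA b hb z) := rfl

theorem hahnExpand_linForm (A : Fin N → Fin s → K) (hA : ∀ i, A i ≠ 0) (b : Fin s → Fin N)
    (hb : LinearIndependent K fun e => A (b e)) (e : Fin s) :
    hahnExpand A hA b hb (algebraMap _ _ (linForm (A (b e)))) =
      HahnSeries.single (flagExp e) 1 := by
  rw [hahnExpand_apply, expand_algebraMap, toHahn_algebraMap, monSubst_linForm A hb,
    monomial_prod_Iic]

/-- The coordinates are combinations of the elements of a basis. -/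
theorem X_eq_sum_linForm (A : Fin N → Fin s → K) {b : Fin s → Fin N}
    (hb : LinearIndependent K fun e => A (b e)) (k : Fin s) :
    (X k : MvPolynomial (Fin s) K) =
      ∑ e, (basisMatrix A b)⁻¹ k e • linForm (A (b e)) := by
  have h : ∀ j, ∑ e, (basisMatrix A b)⁻¹ k e * A (b e) j = if k = j then 1 else 0 := by
    intro j
    have := congrFun (congrFun (Matrix.nonsing_inv_mul _ (basisMatrix_isUnit_det hb)) k) j
    rwa [Matrix.mul_apply, Matrix.one_apply] at this
  simp only [linForm, Finset.smul_sum, smul_eq_C_mul, ← mul_assoc, ← C_mul]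
  rw [Finset.sum_comm]
  simp only [← Finset.sum_mul, ← map_sum, h]
  simp

/-- The chain rule in the coordinates `b`. -/
theorem hahnExpand_partialD (A : Fin N → Fin s → K) (hA : ∀ i, A i ≠ 0) (b : Fin s → Fin N)
    (hb : LinearIndependent K fun e => A (b e)) (k : Fin s) (z : ArrRing A) :
    hahnExpand A hA b hb (partialD A k z) = ∑ e, A (b e) k •
      (HahnSeries.single (-flagExp e) 1 * weightD (flagCoord e) (hahnExpand A hA b hb z)) := by
  set j := hahnExpand A hA b hb
  -- The claim is `∂_k = ∑_e (b_e)_k b_e⁻¹ (b_e ∂/∂b_e)`, with `weightD` as the Euler operator `b_e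
  -- ∂/∂b_e`. The difference of the two sides is a derivation along `j`, so it is enough to test it
  -- on the `b_e`, which span the coordinates.
  let E : ArrRing A →ₗ[K] HahnSeries (Fin s → ℤ) K :=
    j.toLinearMap ∘ₗ (partialD A k : ArrRing A →ₗ[K] ArrRing A) -
      ∑ e, A (b e) k • (LinearMap.mulLeft K (HahnSeries.single (-flagExp e) 1) ∘ₗ
        weightD (flagCoord e) ∘ₗ j.toLinearMap)
  have hE : ∀ z, E z = j (partialD A k z) - ∑ e, A (b e) k •
      (HahnSeries.single (-flagExp e) 1 * weightD (flagCoord e) (j z)) := fun z => by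
    simp [E, LinearMap.sum_apply]
  refine sub_eq_zero.mp ((hE z).symm.trans (eq_zero_of_leibniz A j E ?_ ?_ z))
  · intro x y
    simp only [hE, Derivation.leibniz, map_add, map_mul, weightD_mul, smul_eq_mul, mul_sub,
      Finset.mul_sum, mul_add, smul_add, Finset.sum_add_distrib, mul_smul_comm]
    simp only [mul_left_comm (j _) (HahnSeries.single _ _)]
    ring
  · intro i
    rw [X_eq_sum_linForm A hb i, map_sum, map_sum]
    refine Finset.sum_eq_zero fun f _ => ?_
    have h0 : E (algebraMap (MvPolynomial (Fin s) K) (ArrRing A) (linForm (A (b f)))) = 0 := by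
      rw [hE, hahnExpand_linForm, partialD_algebraMap]
      have h : pderiv k (linForm (A (b f))) = C (A (b f) k) := by
        simp [linForm, pderiv_X, Pi.single_apply]
      rw [h, ← algebraMap_eq, ← IsScalarTower.algebraMap_apply, AlgHom.commutes,
        Finset.sum_eq_single f]
      · rw [weightD_single, flagCoord_flagExp, if_pos rfl, Int.cast_one, one_smul,
          HahnSeries.single_mul_single, neg_add_cancel, mul_one, HahnSeries.single_zero_one,
          Algebra.algebraMap_eq_smul_one, sub_self]
      · intro e _ hef
        rw [weightD_single, flagCoord_flagExp, if_neg hef, Int.cast_zero, zero_smul, mul_zero,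
          smul_zero]
      · simp
    rw [smul_eq_C_mul, map_mul, ← algebraMap_eq, ← IsScalarTower.algebraMap_apply,
      ← Algebra.smul_def, map_smul, h0, smul_zero]

/-- The Jacobian is a single Laurent monomial, so multiplying by it only shifts exponents and
scales. -/
theorem toHahn_jacobian (A : Fin N → Fin s → K) (b : Fin s → Fin N) :
    toHahn K s (algebraMap (MvPowerSeries (Fin s) K) (LaurentRing s K) (jacobian A b)) =
      HahnSeries.single (∑ e, flagExp e + fun _ => -1) (basisMatrix A b)⁻¹.det := by
  have h := congrArg (fun f : MvPolynomial (Fin s) K => psToHahn K s f) (jacobian_mul_prod_X A b)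
  have hX : ((∏ i, X i : MvPolynomial (Fin s) K) : MvPowerSeries (Fin s) K) = allVars s K ^ 1 := by
    rw [pow_one, allVars, ← MvPolynomial.coeToMvPowerSeries.ringHom_apply, map_prod]
    simp
  have hprod : psToHahn K s ((∏ j, ∏ i ∈ Finset.Iic j, (X i : MvPolynomial (Fin s) K) :
      MvPolynomial (Fin s) K) : MvPowerSeries (Fin s) K) =
      HahnSeries.single (∑ e, flagExp e) 1 := by
    rw [← MvPolynomial.coeToMvPowerSeries.ringHom_apply, map_prod, map_prod]
    simp only [MvPolynomial.coeToMvPowerSeries.ringHom_apply, monomial_prod_Iic]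
    generalize (Finset.univ : Finset (Fin s)) = T
    induction T using Finset.induction_on with
    | empty => simp
    | insert a T ha ih =>
      rw [Finset.prod_insert ha, Finset.sum_insert ha, ih, HahnSeries.single_mul_single, one_mul]
  simp only [MvPolynomial.coe_mul, map_mul, hX, hprod, psToHahn_allVars_pow] at h
  rw [MvPolynomial.coe_C, ← MvPowerSeries.monomial_zero_eq_C_apply, psToHahn_monomial, map_zero,
    HahnSeries.single_mul_single, zero_add, mul_one] at h
  rw [toHahn_algebraMap]
  have h1 := congrArg (fun x => x * HahnSeries.single (fun _ : Fin s => (-1 : ℤ)) (1 : K)) h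
  simp only [mul_assoc, HahnSeries.single_mul_single, mul_one] at h1
  rw [← h1]
  convert (mul_one _).symm
  rw [← HahnSeries.single_zero_one]
  congr 1

/-- The residue as a linear form. -/
noncomputable def resLin (A : Fin N → Fin s → K) (hA : ∀ i, A i ≠ 0) (b : NoBrokenBasis A) :
    ArrRing A →ₗ[K] K where
  toFun := res A hA b
  map_add' x y := by
    simp only [res, coeffInv_eq_coeff_toHahn, map_add, add_mul, HahnSeries.coeff_add]
  map_smul' c x := by
    have h := map_smul (hahnExpand A hA b.idx b.linearIndependent) c x
    simp only [hahnExpand_apply] at h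
    rw [res, res, coeffInv_eq_coeff_toHahn, coeffInv_eq_coeff_toHahn, map_mul, map_mul, h,
      smul_mul_assoc]
    rfl

theorem resLin_apply (A : Fin N → Fin s → K) (hA : ∀ i, A i ≠ 0) (b : NoBrokenBasis A)
    (z : ArrRing A) : resLin A hA b z = res A hA b z := rfl

/-- Residues of derivatives vanish. -/
theorem resLin_partialD (A : Fin N → Fin s → K) (hA : ∀ i, A i ≠ 0) (b : NoBrokenBasis A)
    (k : Fin s) (z : ArrRing A) : resLin A hA b (partialD A k z) = 0 := by
  rw [resLin_apply, res, coeffInv_eq_coeff_toHahn, map_mul, toHahn_jacobian, ← hahnExpand_apply,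
    hahnExpand_partialD, Finset.sum_mul, HahnSeries.coeff_sum]
  refine Finset.sum_eq_zero fun e _ => ?_
  set w := hahnExpand A hA b.idx b.linearIndependent z
  -- After the shifts by `b_e⁻¹` and by the Jacobian, the residue reads the weighted series at the
  -- exponent of `b_e / ∏ b_f`. There `b_e` has exponent `1 - 1 = 0`, so the Euler weight kills the
  -- coefficient.
  have hexp : (fun _ : Fin s => (-1 : ℤ)) =
      (flagExp e - ∑ f, flagExp f) + (-flagExp e + (∑ f, flagExp f + fun _ => -1)) := by
    abel
  have hcoeff := HahnSeries.coeff_mul_single_add (x := weightD (flagCoord e) w)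
    (a := flagExp e - ∑ f, flagExp f) (b := -flagExp e + (∑ f, flagExp f + fun _ => -1))
    (r := (basisMatrix A b.idx)⁻¹.det)
  rw [← hexp, coeff_weightD, map_sub, map_sum] at hcoeff
  rw [smul_mul_assoc, mul_right_comm, HahnSeries.single_mul_single, mul_comm, one_mul,
    HahnSeries.coeff_smul, hcoeff]
  simp [flagCoord_flagExp]

theorem resLin_lowerPolar [CharZero K] (A : Fin N → Fin s → K) (hA : ∀ i, A i ≠ 0)
    (b : NoBrokenBasis A) {z : ArrRing A} (hz : z ∈ lowerPolar A) : resLin A hA b z = 0 := by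
  have h : Submodule.span K {z | ∃ k w, partialD A k w = z} ≤ LinearMap.ker (resLin A hA b) := by
    rw [Submodule.span_le]
    rintro _ ⟨k, w, rfl⟩
    exact resLin_partialD A hA b k w
  exact h (lowerPolar_le_span_partialD A hz)

end ResidueOfDerivative

/-! ### Residues of the simple fractions: duality of the no broken bases. -/

section SimpleFractions

variable {K : Type*} [Field K] {s N : ℕ}

/-- A nonzero linear form becomes a monomial `u₁ ⋯ u_e` times a unit. -/
theorem exists_monSubst_linForm_eq (A : Fin N → Fin s → K) {b : Fin s → Fin N}
    (hb : LinearIndependent K fun e => A (b e)) {a : Fin s → K} (ha : a ≠ 0) :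
    ∃ (e : Fin s) (g : MvPolynomial (Fin s) K), constantCoeff g ≠ 0 ∧
      monSubst A b (linForm a) = (∏ l ∈ Finset.Iic e, X l) * g ∧
      a ∈ Submodule.span K ((fun j => A (b j)) '' Set.Ici e) ∧ ∀ f, a = A (b f) → e = f := by
  classical
  obtain ⟨c, hc⟩ : ∃ c : Fin s → K, ∑ e, c e • A (b e) = a := by
    have hsp := hb.span_eq_top_of_card_eq_finrank' (by simp)
    exact (Submodule.mem_span_range_iff_exists_fun K).mp (hsp ▸ Submodule.mem_top)
  have hform : linForm a = ∑ e, C (c e) * linForm (A (b e)) := by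
    simp only [linForm, ← hc, Finset.mul_sum]
    rw [Finset.sum_comm]
    refine Finset.sum_congr rfl fun k _ => ?_
    simp [Finset.sum_apply, Finset.sum_mul, mul_assoc]
  have hex : (Finset.univ.filter fun e => c e ≠ 0).Nonempty := by
    by_contra hcon
    rw [Finset.not_nonempty_iff_eq_empty, Finset.filter_eq_empty_iff] at hcon
    exact ha (hc ▸ Finset.sum_eq_zero fun e _ => by
      rw [not_not.mp (hcon (Finset.mem_univ e)), zero_smul])
  -- After substitution `b_k` divides every later `b_e`, so the first nonzero coefficient gives the
  -- monomial, and the cofactor has constant term `c k ≠ 0`.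
  obtain ⟨k, hk, hmin⟩ := Finset.exists_min_image _ id hex
  have hck : c k ≠ 0 := (Finset.mem_filter.mp hk).2
  have hlt : ∀ e, e < k → c e = 0 := fun e he => by
    by_contra hce
    exact absurd (hmin e (by simpa using hce)) (not_le.mpr he)
  refine ⟨k, ∑ e ∈ Finset.Ici k, C (c e) * ∏ l ∈ Finset.Ioc k e, X l, ?_, ?_, ?_, ?_⟩
  · rw [map_sum, Finset.sum_eq_single_of_mem k (by simp)]
    · simpa using hck
    · intro e he hek
      have hke : k < e := lt_of_le_of_ne (by simpa using he) (Ne.symm hek)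
      rw [map_mul, map_prod, Finset.prod_eq_zero (i := e) (by simpa using hke) (by simp), mul_zero]
  · rw [hform, map_sum, Finset.mul_sum]
    symm
    apply Finset.sum_subset_zero_on_sdiff (Finset.subset_univ _)
    · intro e he
      have : e < k := by simpa using he
      simp [hlt e this]
    · intro e he
      have hke : k ≤ e := by simpa using he
      rw [map_mul, monSubst_linForm A hb, algHom_C, algebraMap_eq, mul_left_comm]
      congr 1
      rw [← Finset.prod_union]
      · congr 1
        ext l
        simp only [Finset.mem_union, Finset.mem_Iic, Finset.mem_Ioc]
        omega
      · rw [Finset.disjoint_left]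
        intro l hl hl'
        simp only [Finset.mem_Iic, Finset.mem_Ioc] at hl hl'
        omega
  · rw [← hc]
    refine Submodule.sum_mem _ fun e _ => ?_
    rcases lt_or_ge e k with he | he
    · rw [hlt e he, zero_smul]
      exact Submodule.zero_mem _
    · exact Submodule.smul_mem _ _ (Submodule.subset_span ⟨e, he, rfl⟩)
  · intro f hf
    have h0 : ∑ e, (c e - (Pi.single f 1 : Fin s → K) e) • A (b e) = 0 := by
      simp [sub_smul, Finset.sum_sub_distrib, hc, hf, Pi.single_apply]
    have h1 := Fintype.linearIndependent_iff.mp hb _ h0 k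
    by_contra hkf
    rw [Pi.single_eq_of_ne hkf, sub_zero] at h1
    exact hck h1

theorem finrank_span_image_eq_card {v : Fin s → Fin s → K} (hv : LinearIndependent K v)
    (T : Finset (Fin s)) :
    Module.finrank K (Submodule.span K (v '' (T : Set (Fin s)))) = T.card := by
  rw [Set.image_eq_range]
  have := finrank_span_eq_card (hv.comp _ (Subtype.val_injective (p := fun x => x ∈ T)))
  rw [Fintype.card_coe] at this
  exact this

theorem NoBrokenBasis.eq_of_idx_eq {A : Fin N → Fin s → K} {b c : NoBrokenBasis A}
    (h : b.idx = c.idx) : b = c := by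
  obtain ⟨b, _, _⟩ := b
  obtain ⟨c, _, _⟩ := c
  cases h
  rfl

theorem NoBrokenBasis.mem_range_of_mem_span {A : Fin N → Fin s → K} (b : NoBrokenBasis A)
    {i : Fin N} {e : Fin s} (hi : i ≤ b.idx e)
    (h : A i ∈ Submodule.span K ((fun j => A (b.idx j)) '' Set.Ici e)) : i ∈ Set.range b.idx := by
  rw [← b.breakingSet_eq]
  exact ⟨e, hi, h⟩

/-- No broken bases inducing the same flag are equal. -/
theorem NoBrokenBasis.eq_of_flag {A : Fin N → Fin s → K} (b c : NoBrokenBasis A)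
    (ν : Fin s → Fin s)
    (hν : ∀ j, A (c.idx j) ∈ Submodule.span K ((fun j => A (b.idx j)) '' Set.Ici (ν j)))
    (hν' : ∀ j f, A (c.idx j) = A (b.idx f) → ν j = f)
    (hcard : ∀ i : Fin s, s - i ≤ (Finset.univ.filter fun j => i ≤ ν j).card) : b = c := by
  apply NoBrokenBasis.eq_of_idx_eq
  ext1 e
  induction e using WellFoundedLT.induction with
  | _ e ih =>
  -- For `j < e` the bases already agree, so `ν j = j < e`. Together with the count `hcard` this
  -- forces `{j | e ≤ ν j}` to be exactly `{j | e ≤ j}`; hence the two tails from `e` on span the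
  -- same space.
  have hsub : (Finset.univ.filter fun j => e ≤ ν j) ⊆ Finset.Ici e := by
    intro j hj
    rw [Finset.mem_Ici]
    by_contra hlt
    rw [not_le] at hlt
    have := hν' j j (by rw [ih j hlt])
    rw [Finset.mem_filter, this] at hj
    exact absurd hj.2 (not_le.mpr hlt)
  have heq := Finset.eq_of_subset_of_card_le hsub (by rw [Fin.card_Ici]; exact hcard e)
  have hle : Submodule.span K ((fun j => A (c.idx j)) '' Set.Ici e) ≤
      Submodule.span K ((fun j => A (b.idx j)) '' Set.Ici e) := by
    rw [Submodule.span_le]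
    rintro _ ⟨j, hj, rfl⟩
    have hj' : j ∈ Finset.univ.filter fun j => e ≤ ν j := heq ▸ Finset.mem_Ici.mpr hj
    exact Submodule.span_mono (Set.image_mono (Set.Ici_subset_Ici.mpr
      (Finset.mem_filter.mp hj').2)) (hν j)
  have hspan := Submodule.eq_of_le_of_finrank_eq hle (by
    rw [← Finset.coe_Ici, finrank_span_image_eq_card c.linearIndependent,
      finrank_span_image_eq_card b.linearIndependent])
  have hce : A (c.idx e) ∈ Submodule.span K ((fun j => A (c.idx j)) '' Set.Ici e) :=
    Submodule.subset_span ⟨e, Set.self_mem_Ici, rfl⟩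
  have hbe : A (b.idx e) ∈ Submodule.span K ((fun j => A (b.idx j)) '' Set.Ici e) :=
    Submodule.subset_span ⟨e, Set.self_mem_Ici, rfl⟩
  -- Whichever of `b_e`, `c_e` stands first in the list lies in the common tail span, hence belongs
  -- to the other basis. It cannot sit at an index below `e`, where the bases already coincide.
  rcases le_total (c.idx e) (b.idx e) with h | h
  · obtain ⟨f, hf⟩ := b.mem_range_of_mem_span h (hspan ▸ hce)
    have hfe : f ≤ e := b.idx.le_iff_le.mp (hf ▸ h)
    rcases hfe.lt_or_eq with hlt | rfl
    · exact absurd (c.idx.injective ((ih f hlt).symm.trans hf)) hlt.ne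
    · exact hf
  · obtain ⟨f, hf⟩ := c.mem_range_of_mem_span h (hspan ▸ hbe)
    have hfe : f ≤ e := c.idx.le_iff_le.mp (hf ▸ h)
    rcases hfe.lt_or_eq with hlt | rfl
    · exact absurd (b.idx.injective ((ih f hlt).trans hf)) hlt.ne
    · exact hf.symm

/-- The Jacobian is `det(b)⁻¹ ∏ b_j / ∏ u_i`; once `z ∏ b_j` is a power series, the coefficient of
`(∏ u_i)⁻¹` is a constant term. -/
theorem res_eq_constantCoeff (A : Fin N → Fin s → K) (hA : ∀ i, A i ≠ 0) (b : NoBrokenBasis A)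
    (z : ArrRing A) (g : MvPowerSeries (Fin s) K)
    (h : expand A hA b.idx b.linearIndependent z *
      algebraMap (MvPowerSeries (Fin s) K) (LaurentRing s K)
        ((∏ j, ∏ i ∈ Finset.Iic j, X i : MvPolynomial (Fin s) K) : MvPowerSeries (Fin s) K) =
      algebraMap _ _ g) :
    res A hA b z = (basisMatrix A b.idx)⁻¹.det * MvPowerSeries.constantCoeff g := by
  have hX : ((∏ i, X i : MvPolynomial (Fin s) K) : MvPowerSeries (Fin s) K) = allVars s K := by
    rw [allVars, ← MvPolynomial.coeToMvPowerSeries.ringHom_apply, map_prod]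
    simp
  rw [res, coeffInv_eq _ (MvPowerSeries.C (basisMatrix A b.idx)⁻¹.det * g) 0]
  · have h0 : constExp s 0 = 0 := by ext; simp [constExp]
    rw [h0, MvPowerSeries.coeff_zero_eq_constantCoeff_apply, map_mul,
      MvPowerSeries.constantCoeff_C]
  · have hJ : (jacobian A b.idx : MvPowerSeries (Fin s) K) * allVars s K =
        MvPowerSeries.C (basisMatrix A b.idx)⁻¹.det *
          ((∏ j, ∏ i ∈ Finset.Iic j, X i : MvPolynomial (Fin s) K) : MvPowerSeries (Fin s) K) := by
      rw [← hX, ← MvPolynomial.coe_mul, jacobian_mul_prod_X, MvPolynomial.coe_mul,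
        MvPolynomial.coe_C]
    rw [zero_add, pow_one, mul_assoc, ← map_mul, hJ, map_mul, mul_left_comm, h, map_mul]

theorem expand_prod_invForm_mul (A : Fin N → Fin s → K) (hA : ∀ i, A i ≠ 0) {b : Fin s → Fin N}
    (hb : LinearIndependent K fun e => A (b e)) (c : Fin s → Fin N) :
    expand A hA b hb (∏ j, invForm A (c j)) *
      algebraMap (MvPowerSeries (Fin s) K) (LaurentRing s K)
        ((∏ j, monSubst A b (linForm (A (c j))) : MvPolynomial (Fin s) K) :
          MvPowerSeries (Fin s) K) = 1 := by
  rw [← map_prod, ← expand_algebraMap A hA b hb, ← map_mul, map_prod, mul_comm,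
    ← Finset.prod_mul_distrib, Finset.prod_congr rfl fun j _ => linForm_mul_invForm A (c j),
    Finset.prod_const_one, map_one]

theorem res_prod_invForm_self (A : Fin N → Fin s → K) (hA : ∀ i, A i ≠ 0) (b : NoBrokenBasis A) :
    res A hA b (∏ j, invForm A (b.idx j)) = (basisMatrix A b.idx)⁻¹.det := by
  rw [res_eq_constantCoeff A hA b _ 1, map_one, mul_one]
  have h := expand_prod_invForm_mul A hA b.linearIndependent b.idx
  rw [Finset.prod_congr rfl fun j _ => monSubst_linForm A b.linearIndependent j] at h
  rw [h, map_one]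

theorem prod_prod_Iic {R : Type*} [CommMonoid R] (x : Fin s → R) (ν : Fin s → Fin s) :
    ∏ j, ∏ i ∈ Finset.Iic (ν j), x i =
      ∏ i, x i ^ (Finset.univ.filter fun j => i ≤ ν j).card := by
  rw [Finset.prod_comm' (t' := Finset.univ) (s' := fun i => Finset.univ.filter fun j => i ≤ ν j)]
  · simp
  · simp

/-- Each `c_j` becomes `u₁ ⋯ u_{ν j}` times a unit, so `u_i` occurs in `∏ c_j` with exponent `n i =
#{j | i ≤ ν j}`. Independence bounds this by `s - i` (indices from `0`), its exponent in `∏ b_j`.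
Equality throughout would give `b = c`, so `∏ b_j / ∏ c_j` is a power series without constant term.
-/
theorem res_prod_invForm_of_ne (A : Fin N → Fin s → K) (hA : ∀ i, A i ≠ 0)
    {b c : NoBrokenBasis A} (hbc : b ≠ c) : res A hA b (∏ j, invForm A (c.idx j)) = 0 := by
  choose ν g hg hsubst hν hν' using fun j =>
    exists_monSubst_linForm_eq A b.linearIndependent (hA (c.idx j))
  set n : Fin s → ℕ := fun i => (Finset.univ.filter fun j => i ≤ ν j).card with hn
  have hle : ∀ i : Fin s, n i ≤ s - i := by
    intro i
    have h : Submodule.span K ((fun j => A (c.idx j)) ''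
        ((Finset.univ.filter fun j => i ≤ ν j : Finset (Fin s)) : Set (Fin s))) ≤
        Submodule.span K ((fun j => A (b.idx j)) '' ((Finset.Ici i : Finset (Fin s)) : Set _)) := by
      rw [Submodule.span_le]
      rintro _ ⟨j, hj, rfl⟩
      rw [Finset.coe_Ici]
      exact Submodule.span_mono (Set.image_mono (Set.Ici_subset_Ici.mpr
        (Finset.mem_filter.mp hj).2)) (hν j)
    have := Submodule.finrank_mono h
    rwa [finrank_span_image_eq_card c.linearIndependent,
      finrank_span_image_eq_card b.linearIndependent, Fin.card_Ici] at this
  obtain ⟨i, hi⟩ : ∃ i : Fin s, n i < s - i := by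
    by_contra hcon
    push Not at hcon
    exact hbc (NoBrokenBasis.eq_of_flag b c ν hν hν' hcon)
  set q : MvPolynomial (Fin s) K := ∏ i, X i ^ (s - i - n i) with hq
  set G : MvPowerSeries (Fin s) K := ((∏ j, g j : MvPolynomial (Fin s) K) : MvPowerSeries (Fin s) K)
  have hG : MvPowerSeries.constantCoeff G ≠ 0 := by
    have : MvPowerSeries.constantCoeff G = constantCoeff (∏ j, g j) := by
      rw [← MvPowerSeries.coeff_zero_eq_constantCoeff_apply, MvPolynomial.coeff_coe]
      rfl
    rw [this, map_prod]
    exact Finset.prod_ne_zero_iff.mpr fun j _ => hg j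
  have hprod : (∏ j, ∏ i ∈ Finset.Iic j, X i : MvPolynomial (Fin s) K) * ∏ j, g j =
      (∏ j, monSubst A b.idx (linForm (A (c.idx j)))) * q := by
    rw [Finset.prod_congr rfl fun j _ => hsubst j, Finset.prod_mul_distrib,
      prod_prod_Iic (X : Fin s → MvPolynomial (Fin s) K) ν,
      prod_prod_Iic (X : Fin s → MvPolynomial (Fin s) K) fun j => j, mul_right_comm]
    congr 1
    rw [hq, ← Finset.prod_mul_distrib]
    refine Finset.prod_congr rfl fun i _ => ?_
    rw [← pow_add]
    have h : (Finset.univ.filter fun j => i ≤ j).card = s - i := by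
      rw [← Fin.card_Ici]
      congr 1
      ext j
      simp
    rw [h, Nat.add_sub_cancel' (hle i)]
  rw [res_eq_constantCoeff A hA b _ ((q : MvPowerSeries (Fin s) K) * G⁻¹), map_mul]
  · have : MvPowerSeries.constantCoeff (q : MvPowerSeries (Fin s) K) = 0 := by
      rw [← MvPowerSeries.coeff_zero_eq_constantCoeff_apply, MvPolynomial.coeff_coe]
      change constantCoeff q = 0
      rw [hq, map_prod]
      refine Finset.prod_eq_zero (Finset.mem_univ i) ?_
      rw [map_pow, constantCoeff_X, zero_pow (by omega)]
    rw [this, zero_mul, mul_zero]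
  · have h1 := congrArg (fun f : MvPolynomial (Fin s) K => (f : MvPowerSeries (Fin s) K)) hprod
    simp only [MvPolynomial.coe_mul] at h1
    have h2 := congrArg (fun f => f * G⁻¹) h1
    simp only [mul_assoc] at h2
    rw [MvPowerSeries.mul_inv_cancel _ hG, mul_one] at h2
    rw [h2, map_mul, ← mul_assoc, expand_prod_invForm_mul, one_mul]

end SimpleFractions

/-! ### Pairing with the exponential: the residue formula and uniqueness. -/

section Pairing

variable {K : Type*} [Field K] {s N : ℕ}

theorem mul_prod_invForm_erase (A : Fin N → Fin s → K) (c : Fin s → Fin N) (e : Fin s) :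
    algebraMap (MvPolynomial (Fin s) K) (ArrRing A) (linForm (A (c e))) * ∏ j, invForm A (c j) =
      ∏ j ∈ Finset.univ.erase e, invForm A (c j) := by
  rw [← Finset.mul_prod_erase _ _ (Finset.mem_univ e), ← mul_assoc, linForm_mul_invForm, one_mul]

/-- Each coordinate is a combination of the `c_e`, and each `c_e` cancels one of the `s` poles. -/
theorem X_mul_prod_invForm_mem_lowerPolar (A : Fin N → Fin s → K) {c : Fin s → Fin N}
    (hc : LinearIndependent K fun e => A (c e)) (k : Fin s) :
    algebraMap (MvPolynomial (Fin s) K) (ArrRing A) (X k) * ∏ j, invForm A (c j) ∈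
      lowerPolar A := by
  rw [X_eq_sum_linForm A hc k, map_sum, Finset.sum_mul]
  refine Submodule.sum_mem _ fun e _ => ?_
  rw [smul_eq_C_mul, map_mul, mul_assoc]
  refine algebraMap_mul_mem_lowerPolar A _ ?_
  obtain ⟨h, hprod, hsupp⟩ := exists_prod_invForm_pow_eq A c (Finset.univ.erase e) fun _ => 1
  simp only [pow_one] at hprod
  rw [mul_prod_invForm_erase, hprod]
  refine Submodule.subset_span ⟨1, h, ?_, by rw [map_one, one_mul]⟩
  have hle := Submodule.finrank_mono (Submodule.span_mono (R := K) (Set.image_mono (f := A) hsupp))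
  rw [Set.image_image, finrank_span_image_eq_card hc, Finset.card_erase_of_mem (Finset.mem_univ e),
    Finset.card_univ, Fintype.card_fin] at hle
  have := e.isLt
  omega

theorem monomial_mul_prod_invForm_mem_lowerPolar (A : Fin N → Fin s → K) {c : Fin s → Fin N}
    (hc : LinearIndependent K fun e => A (c e)) {α : Fin s →₀ ℕ} (hα : α ≠ 0) (r : K) :
    algebraMap (MvPolynomial (Fin s) K) (ArrRing A) (monomial α r) * ∏ j, invForm A (c j) ∈
      lowerPolar A := by
  obtain ⟨k, hk⟩ := Finsupp.ne_iff.mp hα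
  have hle : Finsupp.single k 1 ≤ α :=
    Finsupp.single_le_iff.mpr (Nat.one_le_iff_ne_zero.mpr hk)
  have h : monomial α r = monomial (α - Finsupp.single k 1) r * X k := by
    rw [X, monomial_mul, mul_one, tsub_add_cancel_of_le hle]
  rw [h, map_mul, mul_assoc]
  exact algebraMap_mul_mem_lowerPolar A _ (X_mul_prod_invForm_mem_lowerPolar A hc k)

/-- The generating series of the residues of `x ^ α / α! · z`. -/
noncomputable def resPairing (A : Fin N → Fin s → K) (hA : ∀ i, A i ≠ 0) (b : NoBrokenBasis A)
    (z : ArrRing A) : MvPowerSeries (Fin s) K :=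
  resSeries A hA b (expPairing A * MvPowerSeries.C z)

theorem coeff_of_fun {R : Type*} [Semiring R] (f : (Fin s →₀ ℕ) → R) (α : Fin s →₀ ℕ) :
    MvPowerSeries.coeff α (f : MvPowerSeries (Fin s) R) = f α := rfl

theorem coeff_expPairing (A : Fin N → Fin s → K) (α : Fin s →₀ ℕ) :
    MvPowerSeries.coeff α (expPairing A) =
      algebraMap (MvPolynomial (Fin s) K) (ArrRing A)
        (monomial α (∏ i, ((α i).factorial : K))⁻¹) :=
  coeff_of_fun (fun α => algebraMap (MvPolynomial (Fin s) K) (ArrRing A)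
    (monomial α (∏ i, ((α i).factorial : K))⁻¹)) α

theorem coeff_resSeries (A : Fin N → Fin s → K) (hA : ∀ i, A i ≠ 0) (b : NoBrokenBasis A)
    (F : MvPowerSeries (Fin s) (ArrRing A)) (α : Fin s →₀ ℕ) :
    MvPowerSeries.coeff α (resSeries A hA b F) = res A hA b (MvPowerSeries.coeff α F) :=
  coeff_of_fun (fun α => res A hA b (MvPowerSeries.coeff α F)) α

theorem coeff_resPairing (A : Fin N → Fin s → K) (hA : ∀ i, A i ≠ 0) (b : NoBrokenBasis A)
    (z : ArrRing A) (α : Fin s →₀ ℕ) :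
    MvPowerSeries.coeff α (resPairing A hA b z) = resLin A hA b
      (algebraMap (MvPolynomial (Fin s) K) (ArrRing A)
        (monomial α (∏ i, ((α i).factorial : K))⁻¹) * z) := by
  rw [resPairing, coeff_resSeries, MvPowerSeries.coeff_mul_C, coeff_expPairing, resLin_apply]

theorem resPairing_add (A : Fin N → Fin s → K) (hA : ∀ i, A i ≠ 0) (b : NoBrokenBasis A)
    (x y : ArrRing A) :
    resPairing A hA b (x + y) = resPairing A hA b x + resPairing A hA b y := by
  ext α
  rw [map_add, coeff_resPairing, coeff_resPairing, coeff_resPairing, mul_add, map_add]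

theorem resPairing_smul (A : Fin N → Fin s → K) (hA : ∀ i, A i ≠ 0) (b : NoBrokenBasis A)
    (r : K) (x : ArrRing A) :
    resPairing A hA b (r • x) = r • resPairing A hA b x := by
  ext α
  rw [map_smul, coeff_resPairing, coeff_resPairing, mul_smul_comm, map_smul]

theorem resPairing_sum (A : Fin N → Fin s → K) (hA : ∀ i, A i ≠ 0) (b : NoBrokenBasis A)
    {ι : Type*} (T : Finset ι) (x : ι → ArrRing A) :
    resPairing A hA b (∑ i ∈ T, x i) = ∑ i ∈ T, resPairing A hA b (x i) := by
  ext α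
  simp only [map_sum, coeff_resPairing, Finset.mul_sum]

/-- Integration by parts: the total derivative has no residue, and `∂_k` sends `x^α / α!` to the
coefficient of index `α - e_k`, which is multiplication by `y_k` on generating series. -/
theorem resPairing_partialD [CharZero K] (A : Fin N → Fin s → K) (hA : ∀ i, A i ≠ 0)
    (b : NoBrokenBasis A) (k : Fin s) (z : ArrRing A) :
    resPairing A hA b (partialD A k z) = -MvPowerSeries.X k * resPairing A hA b z := by
  ext α
  set m := algebraMap (MvPolynomial (Fin s) K) (ArrRing A)
    (monomial α (∏ i, ((α i).factorial : K))⁻¹) with hm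
  have h1 : m * partialD A k z = partialD A k (m * z) - partialD A k m * z := by
    rw [Derivation.leibniz, smul_eq_mul, smul_eq_mul, mul_comm z, add_sub_cancel_right]
  rw [coeff_resPairing, ← hm, h1, map_sub, resLin_partialD, zero_sub, neg_mul, map_neg,
    MvPowerSeries.X, MvPowerSeries.coeff_monomial_mul, hm, partialD_algebraMap, pderiv_monomial,
    neg_inj]
  split_ifs with hle
  · rw [one_mul, coeff_resPairing]
    congr 5
    have hk : 1 ≤ α k := Finsupp.single_le_iff.mp hle
    have hfac : ∏ i, ((α i).factorial : K) =
        α k * ∏ i, (((α - Finsupp.single k 1 : Fin s →₀ ℕ) i).factorial : K) := by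
      rw [← Finset.mul_prod_erase _ _ (Finset.mem_univ k),
        ← Finset.mul_prod_erase _ (fun i => (((α - Finsupp.single k 1 : Fin s →₀ ℕ) i).factorial : K))
          (Finset.mem_univ k), ← mul_assoc]
      congr 1
      · rw [Finsupp.tsub_apply, Finsupp.single_eq_same, ← Nat.cast_mul,
          Nat.mul_factorial_pred (by omega)]
      · refine Finset.prod_congr rfl fun i hi => ?_
        rw [Finsupp.tsub_apply, Finsupp.single_eq_of_ne (Finset.ne_of_mem_erase hi), tsub_zero]
    have hk0 : (α k : K) ≠ 0 := Nat.cast_ne_zero.mpr (by omega)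
    rw [hfac, mul_inv, mul_comm, ← mul_assoc, mul_inv_cancel₀ hk0, one_mul]
  · have hk : α k = 0 := by
      by_contra h
      exact hle (Finsupp.single_le_iff.mpr (Nat.one_le_iff_ne_zero.mpr h))
    rw [hk, Nat.cast_zero, mul_zero, monomial_zero, map_zero, zero_mul, map_zero]

theorem resPairing_diffOp [CharZero K] (A : Fin N → Fin s → K) (hA : ∀ i, A i ≠ 0)
    (b : NoBrokenBasis A) (p : MvPolynomial (Fin s) K) (z : ArrRing A) :
    resPairing A hA b (diffOp A p z) =
      ((aeval (fun i => -X i) p : MvPolynomial (Fin s) K) : MvPowerSeries (Fin s) K) *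
        resPairing A hA b z := by
  induction p using MvPolynomial.induction_on generalizing z with
  | C a =>
    rw [diffOp_C, resPairing_smul, algHom_C, algebraMap_eq, MvPolynomial.coe_C,
      MvPowerSeries.smul_eq_C_mul]
  | add p q hp hq =>
    rw [diffOp_add, LinearMap.add_apply, resPairing_add, hp, hq, map_add, MvPolynomial.coe_add,
      add_mul]
  | mul_X p k hp =>
    have h : ((-X k : MvPolynomial (Fin s) K) : MvPowerSeries (Fin s) K) =
        -MvPowerSeries.X k := by
      rw [← MvPolynomial.coeToMvPowerSeries.ringHom_apply, map_neg,
        MvPolynomial.coeToMvPowerSeries.ringHom_apply, MvPolynomial.coe_X]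
    rw [diffOp_mul, diffOp_X, hp, resPairing_partialD, map_mul, aeval_X, MvPolynomial.coe_mul, h,
      mul_assoc]

theorem resPairing_lowerPolar [CharZero K] (A : Fin N → Fin s → K) (hA : ∀ i, A i ≠ 0)
    (b : NoBrokenBasis A) {z : ArrRing A} (hz : z ∈ lowerPolar A) : resPairing A hA b z = 0 := by
  ext α
  rw [coeff_resPairing, resLin_lowerPolar A hA b (algebraMap_mul_mem_lowerPolar A _ hz), map_zero]

/-- The terms with `α ≠ 0` have lower polar order, so only the constant term of the exponential
contributes. -/
theorem resPairing_prod_invForm [CharZero K] (A : Fin N → Fin s → K) (hA : ∀ i, A i ≠ 0)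
    (b c : NoBrokenBasis A) :
    resPairing A hA b (∏ j, invForm A (c.idx j)) =
      MvPowerSeries.C (res A hA b (∏ j, invForm A (c.idx j))) := by
  ext α
  rw [coeff_resPairing, MvPowerSeries.coeff_C]
  split_ifs with hα
  · rw [hα, ← resLin_apply]
    simp
  · exact resLin_lowerPolar A hA b
      (monomial_mul_prod_invForm_mem_lowerPolar A c.linearIndependent hα _)

/-- The residue formula holds for every expansion into no broken bases. -/
theorem IsLocalExpansion.formula [CharZero K] {A : Fin N → Fin s → K} (hA : ∀ i, A i ≠ 0)
    {p : NoBrokenBasis A → MvPolynomial (Fin s) K} (hp : IsLocalExpansion A p)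
    (b : NoBrokenBasis A) :
    ((aeval (fun i => -X i) (p b) : MvPolynomial (Fin s) K) : MvPowerSeries (Fin s) K) =
      (basisMatrix A b.idx).det • resPairing A hA b (∏ i, invForm A i) := by
  have h1 := (Submodule.Quotient.eq _).mp hp.expansion
  have h2 := resPairing_lowerPolar A hA b h1
  have h3 : resPairing A hA b (∏ i, invForm A i) =
      resPairing A hA b (∑ c, diffOp A (p c) (∏ e, invForm A (c.idx e))) := by
    conv_lhs => rw [← sub_add_cancel (∏ i, invForm A i)
      (∑ c, diffOp A (p c) (∏ e, invForm A (c.idx e)))]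
    rw [resPairing_add, h2, zero_add]
  -- By duality only `c = b` survives, and `det(b)` cancels its residue `det(b)⁻¹`.
  rw [h3, resPairing_sum, Finset.sum_eq_single b]
  · rw [resPairing_diffOp, resPairing_prod_invForm, res_prod_invForm_self, ← mul_smul_comm,
      MvPowerSeries.smul_eq_C_mul, ← map_mul, Matrix.det_nonsing_inv,
      Ring.mul_inverse_cancel _ (basisMatrix_isUnit_det b.linearIndependent), map_one, mul_one]
  · intro c _ hcb
    rw [resPairing_diffOp, resPairing_prod_invForm, res_prod_invForm_of_ne A hA hcb.symm,
      map_zero, mul_zero]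
  · intro h
    exact absurd (Finset.mem_univ b) h

theorem aeval_neg_X_injective :
    Function.Injective (aeval (fun i => -X i) :
      MvPolynomial (Fin s) K →ₐ[K] MvPolynomial (Fin s) K) := by
  set φ : MvPolynomial (Fin s) K →ₐ[K] MvPolynomial (Fin s) K := aeval fun i => -X i with hφ
  have h : φ.comp φ = AlgHom.id K _ := by
    refine MvPolynomial.algHom_ext fun i => ?_
    rw [AlgHom.comp_apply, hφ, aeval_X, map_neg, aeval_X, neg_neg, AlgHom.id_apply]
  have h' : ∀ p, φ (φ p) = p := fun p => DFunLike.congr_fun h p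
  exact Function.LeftInverse.injective h'

theorem IsLocalExpansion.unique [CharZero K] {A : Fin N → Fin s → K} (hA : ∀ i, A i ≠ 0)
    {p q : NoBrokenBasis A → MvPolynomial (Fin s) K} (hp : IsLocalExpansion A p)
    (hq : IsLocalExpansion A q) : p = q := by
  funext b
  apply aeval_neg_X_injective
  apply MvPolynomial.coe_injective
  rw [hp.formula hA b, hq.formula hA b]

end Pairing

/-! ### Existence of an expansion by reduction to no broken bases. -/

section Existence

variable {K : Type*} [Field K] {s N : ℕ} (A : Fin N → Fin s → K)

/-- The elements of `R_X` with an expansion into no broken bases with coefficients homogeneous of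
degree `m`, modulo lower polar order. -/
noncomputable def expandable (m : ℕ) : Submodule K (ArrRing A) where
  carrier := {z | ∃ q : NoBrokenBasis A → MvPolynomial (Fin s) K, (∀ b, (q b).IsHomogeneous m) ∧
    (lowerPolar A).mkQ z =
      (lowerPolar A).mkQ (∑ b, diffOp A (q b) (∏ e, invForm A (b.idx e)))}
  zero_mem' := ⟨fun _ => 0, fun _ => isHomogeneous_zero _ _ _, by
    simp [← diffOpHom_apply]⟩
  add_mem' := by
    rintro x y ⟨p, hp, hx⟩ ⟨q, hq, hy⟩
    refine ⟨fun b => p b + q b, fun b => (hp b).add (hq b), ?_⟩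
    rw [map_add, hx, hy, ← map_add, ← Finset.sum_add_distrib]
    simp only [diffOp_add, LinearMap.add_apply]
  smul_mem' := by
    rintro c x ⟨p, hp, hx⟩
    refine ⟨fun b => c • p b, fun b => ?_, ?_⟩
    · change (c • p b).IsHomogeneous m
      rw [smul_eq_C_mul, ← zero_add m]
      exact (isHomogeneous_C _ _).mul (hp b)
    · rw [map_smul, hx, ← map_smul, Finset.smul_sum]
      simp only [diffOp_smul, LinearMap.smul_apply]

theorem lowerPolar_le_expandable (m : ℕ) : lowerPolar A ≤ expandable A m := fun z hz =>
  ⟨fun _ => 0, fun _ => isHomogeneous_zero _ _ _, by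
    rw [Submodule.mkQ_apply, (Submodule.Quotient.mk_eq_zero _).mpr hz]
    simp [← diffOpHom_apply]⟩

theorem diffOp_mem_expandable {m : ℕ} (b : NoBrokenBasis A) {q : MvPolynomial (Fin s) K}
    (hq : q.IsHomogeneous m) :
    diffOp A q (∏ e, invForm A (b.idx e)) ∈ expandable A m := by
  classical
  refine ⟨Pi.single b q, fun c => ?_, ?_⟩
  · by_cases h : c = b
    · subst h; rwa [Pi.single_eq_same]
    · rw [Pi.single_eq_of_ne h]; exact isHomogeneous_zero _ _ _
  · rw [Finset.sum_eq_single b]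
    · rw [Pi.single_eq_same]
    · intro c _ hc
      rw [Pi.single_eq_of_ne hc, ← diffOpHom_apply, map_zero, LinearMap.zero_apply]
    · intro h
      exact absurd (Finset.mem_univ b) h

theorem linForm_isHomogeneous (v : Fin s → K) : (linForm v).IsHomogeneous 1 :=
  IsHomogeneous.sum _ _ _ fun k _ => by
    simpa using (isHomogeneous_C (Fin s) (v k)).mul (isHomogeneous_X K k)

/-- Differentiating a simple fraction along the dual basis. -/
theorem dirD_dual_prod_invForm_pow {b : Fin s → Fin N}
    (hb : LinearIndependent K fun e => A (b e)) (e : Fin s) (m : Fin s → ℕ) :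
    dirD A (fun k => (basisMatrix A b)⁻¹ k e) (∏ f, invForm A (b f) ^ (m f + 1)) =
      -((m e + 1 : K) • ∏ f, invForm A (b f) ^ ((m + Pi.single e 1 : Fin s → ℕ) f + 1)) := by
  set v := fun k => (basisMatrix A b)⁻¹ k e with hv
  have hdual : ∀ f, ∑ k, v k * A (b f) k = if f = e then 1 else 0 := by
    intro f
    have := congrFun (congrFun (Matrix.mul_nonsing_inv _ (basisMatrix_isUnit_det hb)) f) e
    rw [Matrix.mul_apply, Matrix.one_apply] at this
    rw [← this]
    exact Finset.sum_congr rfl fun k _ => mul_comm _ _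
  have h0 : dirD A v (∏ f ∈ Finset.univ.erase e, invForm A (b f) ^ (m f + 1)) = 0 := by
    refine Finset.prod_induction _ (fun z => dirD A v z = 0) (fun x y hx hy => ?_)
      (Derivation.map_one_eq_zero _) fun f hf => ?_
    · rw [Derivation.leibniz, hx, hy, smul_zero, smul_zero, add_zero]
    · rw [Derivation.leibniz_pow, dirD_invForm, hdual, if_neg (Finset.ne_of_mem_erase hf)]
      simp
  have hrest : ∏ f, invForm A (b f) ^ ((m + Pi.single e 1 : Fin s → ℕ) f + 1) =
      invForm A (b e) ^ (m e + 2) *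
        ∏ f ∈ Finset.univ.erase e, invForm A (b f) ^ (m f + 1) := by
    rw [← Finset.mul_prod_erase _ _ (Finset.mem_univ e), Pi.add_apply, Pi.single_eq_same]
    congr 1
    refine Finset.prod_congr rfl fun f hf => ?_
    rw [Pi.add_apply, Pi.single_eq_of_ne (Finset.ne_of_mem_erase hf), add_zero]
  rw [hrest, ← Finset.mul_prod_erase _ _ (Finset.mem_univ e), Derivation.leibniz, h0, smul_zero,
    zero_add, Derivation.leibniz_pow, dirD_invForm, hdual, if_pos rfl, one_smul, Nat.add_sub_cancel,
    smul_eq_mul, smul_eq_mul, nsmul_eq_mul, Algebra.smul_def]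
  push_cast
  ring

theorem single_one_le {ι : Type*} [DecidableEq ι] {m : ι → ℕ} {e : ι} (he : 1 ≤ m e) :
    Pi.single e 1 ≤ m := fun i => by
  by_cases h : i = e
  · subst h; rwa [Pi.single_eq_same]
  · rw [Pi.single_eq_of_ne h]; exact Nat.zero_le _

/-- Each factor `-(m_e + 1)⁻¹ ∂/∂b_e` raises the exponent of `1/b_e` by one; the division uses
characteristic zero. -/
theorem exists_diffOp_eq_prod_invForm_pow [CharZero K] {b : Fin s → Fin N}
    (hb : LinearIndependent K fun e => A (b e)) (n : ℕ) :
    ∀ m : Fin s → ℕ, ∑ e, m e = n → ∃ q : MvPolynomial (Fin s) K, q.IsHomogeneous n ∧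
      diffOp A q (∏ e, invForm A (b e)) = ∏ e, invForm A (b e) ^ (m e + 1) := by
  classical
  induction n with
  | zero =>
    intro m hm
    have : ∀ e, m e = 0 := fun e => (Finset.sum_eq_zero_iff.mp hm) e (Finset.mem_univ e)
    refine ⟨C 1, isHomogeneous_C _ _, ?_⟩
    rw [diffOp_C, one_smul]
    simp [this]
  | succ n ih =>
    intro m hm
    obtain ⟨e, -, he⟩ := Finset.exists_ne_zero_of_sum_ne_zero (hm.trans_ne n.succ_ne_zero)
    obtain ⟨m', rfl⟩ : ∃ m' : Fin s → ℕ, m = m' + Pi.single e 1 :=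
      ⟨m - Pi.single e 1, (tsub_add_cancel_of_le (single_one_le
        (Nat.one_le_iff_ne_zero.mpr he))).symm⟩
    obtain ⟨q, hq, hqe⟩ := ih m' (by
      simpa [Finset.sum_add_distrib] using hm)
    have hne : (m' e + 1 : K) ≠ 0 := Nat.cast_add_one_ne_zero _
    refine ⟨C (-(m' e + 1 : K)⁻¹) * (linForm (fun k => (basisMatrix A b)⁻¹ k e) * q), ?_, ?_⟩
    · have := (isHomogeneous_C (Fin s) (-(m' e + 1 : K)⁻¹)).mul
        ((linForm_isHomogeneous fun k => (basisMatrix A b)⁻¹ k e).mul hq)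
      rwa [zero_add, add_comm 1 n] at this
    · rw [diffOp_mul, diffOp_mul, diffOp_C, hqe, diffOp_linForm,
        dirD_dual_prod_invForm_pow A hb, smul_neg, neg_smul, neg_neg, smul_smul,
        inv_mul_cancel₀ hne, one_smul]

/-- If no form of the list is a combination of later elements of `T`, and `T` spans, then `T` is a
no broken basis. -/
theorem exists_noBrokenBasis (T : Finset (Fin N))
    (hT : ∀ i, A i ∉ Submodule.span K (A '' {j | j ∈ T ∧ i < j}))
    (hs : s ≤ Module.finrank K (Submodule.span K (A '' (T : Set (Fin N))))) :
    ∃ b : NoBrokenBasis A, Finset.univ.map b.idx.toEmbedding = T := by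
  classical
  -- In a nontrivial relation the first element of `T` with nonzero coefficient would be a
  -- combination of later ones.
  have hind : LinearIndepOn K A (T : Set (Fin N)) := by
    rw [linearIndepOn_finset_iff]
    intro g hg
    by_contra hcon
    push Not at hcon
    have hex : (T.filter fun i => g i ≠ 0).Nonempty := by
      obtain ⟨i, hi, hgi⟩ := hcon
      exact ⟨i, Finset.mem_filter.mpr ⟨hi, hgi⟩⟩
    obtain ⟨i, hi, hmin⟩ := Finset.exists_min_image _ id hex
    obtain ⟨hiT, hgi⟩ := Finset.mem_filter.mp hi
    apply hT i
    rw [← Finset.add_sum_erase _ _ hiT] at hg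
    have h1 : g i • A i ∈ Submodule.span K (A '' {j | j ∈ T ∧ i < j}) := by
      rw [eq_neg_of_add_eq_zero_left hg]
      refine Submodule.neg_mem _ (Submodule.sum_mem _ fun j hj => ?_)
      obtain ⟨hji, hjT⟩ := Finset.mem_erase.mp hj
      by_cases hgj : g j = 0
      · rw [hgj, zero_smul]
        exact Submodule.zero_mem _
      · exact Submodule.smul_mem _ _ (Submodule.subset_span ⟨j, ⟨hjT,
          lt_of_le_of_ne (hmin j (Finset.mem_filter.mpr ⟨hjT, hgj⟩)) hji.symm⟩, rfl⟩)
    exact (Submodule.smul_mem_iff _ hgi).mp h1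
  have hcard : T.card = s := by
    have h1 : Module.finrank K (Submodule.span K (A '' (T : Set (Fin N)))) = T.card := by
      rw [Set.image_eq_range]
      have := finrank_span_eq_card hind
      exact this.trans (Fintype.card_coe T)
    have h2 := Submodule.finrank_le (Submodule.span K (A '' (T : Set (Fin N))))
    rw [Module.finrank_fin_fun] at h2
    omega
  have hmem := T.orderEmbOfFin_mem hcard
  refine ⟨⟨T.orderEmbOfFin hcard, ?_, ?_⟩, ?_⟩
  · exact hind.comp (fun e => ⟨T.orderEmbOfFin hcard e, hmem e⟩)
      fun e f h => (T.orderEmbOfFin hcard).injective (Subtype.ext_iff.mp h)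
  · ext i
    constructor
    · rintro ⟨e, hie, hi⟩
      -- A breaking element standing strictly before `b_e` would be a combination of elements of `T`
      -- after it, against `hT`.
      rcases hie.eq_or_lt with rfl | hlt
      · exact ⟨e, rfl⟩
      · refine absurd (Submodule.span_mono ?_ hi) (hT i)
        rintro _ ⟨j, hj, rfl⟩
        exact ⟨_, ⟨hmem j, hlt.trans_le ((T.orderEmbOfFin hcard).monotone hj)⟩, rfl⟩
    · rintro ⟨e, rfl⟩
      exact ⟨e, le_rfl, Submodule.subset_span ⟨e, Set.self_mem_Ici, rfl⟩⟩
  · exact T.map_orderEmbOfFin_univ hcard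

theorem prod_invForm_pow_add (h g : Fin N → ℕ) :
    ∏ i, invForm A i ^ (h + g) i = (∏ i, invForm A i ^ h i) * ∏ i, invForm A i ^ g i := by
  simp only [Pi.add_apply, pow_add, Finset.prod_mul_distrib]

theorem prod_invForm_pow_single (i : Fin N) :
    ∏ j, invForm A j ^ (Pi.single i 1 : Fin N → ℕ) j = invForm A i := by
  rw [Finset.prod_eq_single i]
  · simp
  · intro j _ hj
    simp [hj]
  · simp

/-- Every product of inverses of elements of the list has an expansion into no broken bases. -/
theorem prod_invForm_pow_mem_expandable [CharZero K] (n : ℕ) :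
    ∀ h : Fin N → ℕ, ∑ i, h i * (i : ℕ) = n →
      ∏ i, invForm A i ^ h i ∈ expandable A (∑ i, h i - s) := by
  classical
  induction n using Nat.strong_induction_on with
  | _ n ih =>
  intro h hn
  set T : Finset (Fin N) := Finset.univ.filter fun j => 0 < h j with hTdef
  -- If `a_i` is a combination of later poles, multiply by `1 = a_i⁻¹ ∑ c_j a_j`. Each term trades
  -- one pole `a_j` for `a_i` with `i < j`: the total order `∑ h` is kept and the weight `∑ h_i · i`
  -- drops, whether or not `a_i` was already a pole.
  by_cases hred : ∃ i, A i ∈ Submodule.span K (A '' {j | j ∈ T ∧ i < j})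
  · obtain ⟨i, hi⟩ := hred
    have key : ∀ a ∈ Submodule.span K (A '' {j | j ∈ T ∧ i < j}),
        invForm A i * (algebraMap (MvPolynomial (Fin s) K) (ArrRing A) (linForm a) *
          ∏ l, invForm A l ^ h l) ∈ expandable A (∑ i, h i - s) := by
      intro a ha
      induction ha using Submodule.span_induction with
      | mem a ha =>
        obtain ⟨j, ⟨hjT, hij⟩, rfl⟩ := ha
        have hj : 0 < h j := (Finset.mem_filter.mp hjT).2
        obtain ⟨g, rfl⟩ : ∃ g : Fin N → ℕ, h = g + Pi.single j 1 :=
          ⟨h - Pi.single j 1, (tsub_add_cancel_of_le (single_one_le hj)).symm⟩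
        rw [prod_invForm_pow_add, prod_invForm_pow_single, mul_left_comm (algebraMap _ _ _),
          linForm_mul_invForm, mul_one, mul_comm, ← prod_invForm_pow_single A i,
          ← prod_invForm_pow_add]
        have hsum : ∑ l, (g + Pi.single j 1 : Fin N → ℕ) l = ∑ l, (g + Pi.single i 1 : Fin N → ℕ) l := by
          simp [Finset.sum_add_distrib]
        rw [hsum]
        refine ih _ ?_ _ rfl
        rw [← hn]
        simp only [Pi.add_apply, add_mul, Finset.sum_add_distrib, Pi.single_apply, ite_mul,
          one_mul, zero_mul, Finset.sum_ite_eq', Finset.mem_univ, if_true]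
        have : (i : ℕ) < j := hij
        omega
      | zero => simp [linForm]
      | add x y _ _ hx hy =>
        have hxy : linForm (x + y) = linForm x + linForm y := by
          simp [linForm, add_mul, Finset.sum_add_distrib]
        rw [hxy, map_add, add_mul, mul_add]
        exact Submodule.add_mem _ hx hy
      | smul c x _ hx =>
        have hcx : linForm (c • x) = c • linForm x := by
          simp [linForm, Finset.smul_sum, smul_eq_C_mul, mul_assoc]
        rw [hcx, smul_eq_C_mul, map_mul, ← algebraMap_eq, ← IsScalarTower.algebraMap_apply,
          ← Algebra.smul_def, smul_mul_assoc, mul_smul_comm]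
        exact Submodule.smul_mem _ _ hx
    have := key _ hi
    rwa [← mul_assoc, mul_comm (invForm A i), linForm_mul_invForm, one_mul] at this
  · push Not at hred
    have hTset : (T : Set (Fin N)) = {i | 0 < h i} := by
      ext i
      simp [hTdef]
    rcases lt_or_ge (Module.finrank K (Submodule.span K (A '' (T : Set (Fin N))))) s with hlt | hge
    · refine lowerPolar_le_expandable A _ (Submodule.subset_span ⟨1, h, hTset ▸ hlt, ?_⟩)
      rw [map_one, one_mul]
    · obtain ⟨b, hb⟩ := exists_noBrokenBasis A T hred hge
      have hpos : ∀ e, 0 < h (b.idx e) := fun e => by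
        have : b.idx e ∈ T := hb ▸ Finset.mem_map_of_mem _ (Finset.mem_univ e)
        exact (Finset.mem_filter.mp this).2
      have hout : ∀ i, i ∉ T → h i = 0 := fun i hi => by
        simpa [hTdef] using hi
      -- The `s` poles of the basis have order at least one each, so the excess order, which is the
      -- degree of the operator, is `∑ h - s`.
      have hsum : ∑ i, h i = ∑ e, (h (b.idx e) - 1) + s := by
        rw [← Finset.sum_subset (Finset.subset_univ T) fun i _ hi => hout i hi, ← hb,
          Finset.sum_map]
        calc ∑ e, h (b.idx e) = ∑ e, ((h (b.idx e) - 1) + 1) :=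
              Finset.sum_congr rfl fun e _ => (Nat.sub_add_cancel (hpos e)).symm
          _ = _ := by simp [Finset.sum_add_distrib]
      obtain ⟨q, hq, hqe⟩ := exists_diffOp_eq_prod_invForm_pow A b.linearIndependent _
        (fun e => h (b.idx e) - 1) rfl
      have hprod : ∏ i, invForm A i ^ h i = diffOp A q (∏ e, invForm A (b.idx e)) := by
        rw [hqe, ← Finset.prod_subset (Finset.subset_univ T) fun i _ hi => by
          rw [hout i hi, pow_zero], ← hb, Finset.prod_map]
        exact Finset.prod_congr rfl fun e _ => by
          rw [Nat.sub_add_cancel (hpos e)]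
          rfl
      rw [hprod, hsum, Nat.add_sub_cancel]
      exact diffOp_mem_expandable A b hq

theorem exists_isLocalExpansion [CharZero K] : ∃ p, IsLocalExpansion A p := by
  obtain ⟨q, hq, hqe⟩ := prod_invForm_pow_mem_expandable A _ (fun _ => 1) rfl
  simp only [Finset.sum_const, Finset.card_univ, Fintype.card_fin, smul_eq_mul, mul_one,
    pow_one] at hq hqe
  exact ⟨q, hq, hqe⟩

end Existence

end LocalResidue

theorem mainTheorem10 {K : Type*} [Field K] [CharZero K] (s N : ℕ)
    (A : Fin N → Fin s → K) (hA : ∀ i, A i ≠ 0)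
    (hspan : Submodule.span K (Set.range A) = ⊤) :
    (∃! p : LocalResidue.NoBrokenBasis A → MvPolynomial (Fin s) K,
      LocalResidue.IsLocalExpansion A p) ∧
    ∀ b : LocalResidue.NoBrokenBasis A,
      ((MvPolynomial.aeval (fun i => -MvPolynomial.X i) (LocalResidue.localPoly A b) :
          MvPolynomial (Fin s) K) : MvPowerSeries (Fin s) K) =
        (LocalResidue.basisMatrix A b.idx).det •
          LocalResidue.resSeries A hA b
            (LocalResidue.expPairing A *
              MvPowerSeries.C (∏ i, LocalResidue.invForm A i)) := by
  obtain ⟨p, hp⟩ := LocalResidue.exists_isLocalExpansion A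
  have hloc : LocalResidue.IsLocalExpansion A (LocalResidue.localPoly A) :=
    Classical.epsilon_spec ⟨p, hp⟩
  exact ⟨⟨p, hp, fun q hq => hq.unique hA hp⟩, fun b => hloc.formula hA b⟩
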